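/- **Corollary 3.** Let $E$ take values in a finite interval $[e_{\min},e_{\max}]$, $e_{\min}<e_{\max}$, and let $f_{Q|E}(\cdot|e)$, $e\in[e_{\min},e_{\max}]$, be a (jointly measurable) family of probability densities on a finite range $(q_{\min},q_{\max})$, each with a finite differential entropy $h(Q|e)=-\int f_{Q|E}(q|e)\log_2 f_{Q|E}(q|e)\,dq$. Write $m(e)$ and $\sigma(e)$ for the mean and the standard deviation of $f_{Q|E}(\cdot|e)$, and $\sigma_{\max}=\sup_e\sigma(e)$. Suppose that, for given constants $\rho>0$, $L$ and $\kappa$, * $m$ is continuous on $[e_{\min},e_{\max}]$ and differentiable with $m'(e)>0$ on $(e_{\min},e_{\max})$, and $m(e_{\max})-m(e_{\min})\ge\rho$; * $\sigma$ is continuous on $[e_{\min},e_{\max}]$ and changes slowly: it is differentiable on $(e_{\min},e_{\max})$ with $\left|\frac{d\ln\sigma(e)}{de}\right|\le L$; * the standardised densities $\phi(x|e)=\sigma(e)\,f_{Q|E}(m(e)+\sigma(e)x\,|\,e)$ have differential entropy at least $-\kappa$, that is, $h(Q|e)\ge\log_2\sigma(e)-\kappa$ for all $e$. Let $\tilde P_E$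 be a law of $E$ that maximises the mutual information $I(Q;E)=\int\left[h(Q)-h(Q|e)\right]dP_E(e)$, where $h(Q)$ is the entropy of the density $f_Q(q)=\int f_{Q|E}(q|e)\,dP_E(e)$; the maximum is either over all laws $P_E$ with a density, $\tilde P_E$ then being a law with a density $\tilde f_E$, or over all Borel probability measures on $[e_{\min},e_{\max}]$. Let $\tilde F_E$ be the cumulative distribution function of $\tilde P_E$, let $\tilde F_Q$ be that of the corresponding density $\tilde f_Q(q)=\int f_{Q|E}(q|e)\,d\tilde P_E(e)$, and put $E^*=\tilde F_E(E)$, $Q^*=\tilde F_Q(Q)$. For $0<e^*<1$ let $$m^*(e^*)=\int \tilde F_Q(q)\,f_{Q|E}\big(q\,\big|\,\tilde F_E^{-1}(e^*)\big)\,dq$$ be the mean of $Q^*$ when $E^*=e^*$, where $\tilde F_E^{-1}(e^*)=\inf\{e:\tilde F_E(e)\ge e^*\}$. Then $$m^*(e^*)=e^*+O(\sigma_{\max}),$$ uniformly: there is a constant $K$, depending only on $e_{\min},e_{\max},\rho,L,\kappa$, such that $|m^*(e^*)-e^*|\le K\sigma_{\max}$ for all $e^*\in(0,1)$, and moreover $\left|\int\tilde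 F_Q(q)f_{Q|E}(q|e)\,dq-\tilde F_E(e)\right|\le K\sigma_{\max}$ for every $e\in[e_{\min},e_{\max}]$. -/

import Mathlib

open MeasureTheory Set

noncomputable section

/-- The differential entropy (in bits) of a density `g` on the real line; `0 * log 0 = 0`. -/
def diffEntropy (g : ℝ → ℝ) : ℝ := -∫ q, g q * Real.logb 2 (g q)

/-- A family of conditional densities `f q e = f_{Q|E}(q|e)` of a real variable `Q` given the value
`e` of a real variable `E`, where `E` takes values in `[emin, emax]` and `Q` in the finite range
`(qmin, qmax)`, every conditional density having a (finite) differential entropy. -/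
structure Channel (emin emax : ℝ) where
  qmin : ℝ
  qmax : ℝ
  f : ℝ → ℝ → ℝ
  measurable_f : Measurable (Function.uncurry f)
  nonneg : ∀ e ∈ Icc emin emax, ∀ q, 0 ≤ f q e
  finite_range : ∀ e ∈ Icc emin emax, ∀ q, q ∉ Ioo qmin qmax → f q e = 0
  normalised : ∀ e ∈ Icc emin emax, ∫ q, f q e = 1
  finite_entropy : ∀ e ∈ Icc emin emax, Integrable (fun q => f q e * Real.logb 2 (f q e))

namespace Channel

variable {emin emax : ℝ} (C : Channel emin emax)

/-- `m(e)`, the mean of `Q` when `E = e`. -/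
def mean (e : ℝ) : ℝ := ∫ q, q * C.f q e

/-- `σ(e)`, the standard deviation of `Q` when `E = e`. -/
def sd (e : ℝ) : ℝ := Real.sqrt (∫ q, (q - C.mean e) ^ 2 * C.f q e)

/-- `σ_max`, the largest standard deviation of `Q` given `E = e`, over all values of `e`. -/
def sdMax : ℝ := sSup (C.sd '' Icc emin emax)

/-- `h(Q|e)`, the entropy of `Q` when `E = e`. -/
def condEntropy (e : ℝ) : ℝ := diffEntropy (fun q => C.f q e)

/-- `f_Q`, the density of `Q` when `E` has the law `μ`. -/
def outputDensity (μ : Measure ℝ) (q : ℝ) : ℝ := ∫ e, C.f q e ∂μ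

/-- `I(Q;E)`, the mutual information (in bits) when `E` has the law `μ`: the average over `e` of
`I(Q;e) = h(Q) - h(Q|e)`. -/
def mutualInfo (μ : Measure ℝ) : ℝ :=
  ∫ e, (diffEntropy (C.outputDensity μ) - C.condEntropy e) ∂μ

/-- All laws of `E`: the Borel probability measures carried by `[emin, emax]`. -/
def allLaws (_C : Channel emin emax) : Set (Measure ℝ) :=
  {μ | IsProbabilityMeasure μ ∧ μ (Icc emin emax)ᶜ = 0}

/-- The laws of `E` that have a probability density. -/
def densityLaws : Set (Measure ℝ) := {μ | μ ∈ C.allLaws ∧ μ ≪ volume}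

/-- `μ` maximises the mutual information among the laws in the class `P`. -/
def IsInfoMaximising (P : Set (Measure ℝ)) (μ : Measure ℝ) : Prop :=
  μ ∈ P ∧ IsMaxOn C.mutualInfo P μ

/-- `F_E`, the cumulative distribution function of the law `μ` of `E`; `E* = F_E(E)`. -/
def cdfE (_C : Channel emin emax) (μ : Measure ℝ) (e : ℝ) : ℝ := μ.real (Iic e)

/-- `F_Q`, the cumulative distribution function of `Q` when `E` has the law `μ`; `Q* = F_Q(Q)`. -/
def cdfQ (μ : Measure ℝ) (q : ℝ) : ℝ := ∫ x in Iic q, C.outputDensity μ x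

/-- The mean of `Q* = F_Q(Q)` when `E = e`. -/
def meanQStar (μ : Measure ℝ) (e : ℝ) : ℝ := ∫ q, C.cdfQ μ q * C.f q e

/-- The value of `E` that corresponds to the value `eStar` of `E* = F_E(E)`, i.e. the inverse
of `F_E` (the generalised inverse, where `F_E` is not bijective). -/
def invCdfE (μ : Measure ℝ) (eStar : ℝ) : ℝ :=
  sInf {e | e ∈ Icc emin emax ∧ eStar ≤ C.cdfE μ e}

/-- `m*(e*)`, the mean of `Q*` when `E* = e*`. -/
def mStar (μ : Measure ℝ) (eStar : ℝ) : ℝ := C.meanQStar μ (C.invCdfE μ eStar)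

end Channel

end

-- Write `s` for `σ_max`. The heart of the matter is that an optimal law `μ` cannot concentrate:
-- every window `{e | |m(e) - c| ≤ s}` has `μ`-mass at most a constant times `s` (`window_le`).
--
-- To see this, remove the part of `μ` on a window, of mass `p`, and spread the same mass according
-- to the law `ν₀` that makes `m(E)` uniform. The functional `∫ -F log F` is subadditive in
-- unnormalised output densities and concave, so optimality gives `p I(ν₀) - p ≤ h(ν₂) - ∫ h(Q|e)
-- dν₂` in nats, where `ν₂` is the removed part (`optimal_replace`). The information of `ν₀` is at
-- least `log(1/s)` up to a constant (`le_info_uniformMeanLaw`). The output of `ν₂` lives on scale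
-- `s`, so its entropy is at most `-p log p + p log s + O(p)` (`outputEntropyNat_le`), while slow
-- change of `σ` and nondegeneracy give `h(Q|e) ≥ log s - O(1)`. The terms in `s` combine to `log p
-- ≤ log s + O(1)`.
--
-- Next, the mean of `Q*` given `e`, minus `F_E(e)`, is the average over `e'` of `P(Q' ≤ Q) - 1{e' ≤
-- e}`. Since `m` is increasing, Chebyshev bounds this error by `5 / (1 + ((m(e') - m(e)) / s)²)`
-- (`abs_orderProb_sub_le`), and the window bound makes the average of that profile `O(s)`
-- (`integral_inv_one_add_sq_le`). Finally, a jump of `F_E` at a quantile is at most the mass of one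
-- window, which passes from `F_E(e)` to `e*`.

noncomputable section

-- Inequalities for `-u log u`.

open Real in
/-- Gibbs' inequality in pointwise form. -/
theorem negMulLog_le_sub_sub_mul_log {u w : ℝ} (hu : 0 ≤ u) (hw : 0 < w) :
    negMulLog u ≤ w - u - u * log w := by
  rcases hu.eq_or_lt with rfl | hu
  · simpa using hw.le
  have h := log_le_sub_one_of_pos (div_pos hw hu)
  rw [log_div hw.ne' hu.ne'] at h
  have h2 := mul_le_mul_of_nonneg_left h hu.le
  have h3 : u * (w / u - 1) = w - u := by field_simp
  rw [h3] at h2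
  unfold negMulLog
  linarith

open Real in
theorem negMulLog_le_one {u : ℝ} (hu : 0 ≤ u) : negMulLog u ≤ 1 := by
  have := negMulLog_le_sub_sub_mul_log hu one_pos
  simp at this
  linarith

-- Since `-u log u` is bounded above, its absolute integral over a bounded range is controlled by a
-- lower bound on the entropy. All integrability of entropies below rests on this.
open Real in
theorem abs_negMulLog_le {u : ℝ} (hu : 0 ≤ u) : |negMulLog u| ≤ 2 - negMulLog u := by
  have := negMulLog_le_one hu
  rw [abs_le]; constructor <;> linarith

open Real in
theorem negMulLog_add_le {x y : ℝ} (hx : 0 ≤ x) (hy : 0 ≤ y) :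
    negMulLog (x + y) ≤ negMulLog x + negMulLog y := by
  rcases hx.eq_or_lt with rfl | hx
  · simp
  rcases hy.eq_or_lt with rfl | hy
  · simp
  have h1 := log_le_log hx (by linarith : x ≤ x + y)
  have h2 := log_le_log hy (by linarith : y ≤ x + y)
  unfold negMulLog
  nlinarith [mul_le_mul_of_nonneg_left h1 hx.le, mul_le_mul_of_nonneg_left h2 hy.le]

open Real in
/-- Concavity of `negMulLog`, for a part of total mass `1 - p` and a part of total mass `p`. -/
theorem add_mul_negMulLog_le {x y p : ℝ} (hx : 0 ≤ x) (hy : 0 ≤ y) (hp : 0 ≤ p) (hp1 : p ≤ 1)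
    (hx0 : p = 1 → x = 0) :
    negMulLog x + x * log (1 - p) + p * negMulLog y ≤ negMulLog (x + p * y) := by
  rcases hp1.eq_or_lt with rfl | hp1
  · simp [hx0 rfl]
  have hs : 0 < 1 - p := by linarith
  have h := concaveOn_negMulLog.2 (x := x / (1 - p)) (y := y) (div_nonneg hx hs.le) hy hs.le hp
    (by ring)
  simp only [smul_eq_mul] at h
  rw [mul_div_cancel₀ _ hs.ne'] at h
  refine le_trans (le_of_eq ?_) h
  congr 1
  rcases hx.eq_or_lt with rfl | hx
  · simp
  unfold negMulLog
  rw [log_div hx.ne' hs.ne']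
  field_simp
  ring

open Real in
/-- Jensen's inequality for `negMulLog`, weighted by `w`. -/
theorem integral_negMulLog_le {α : Type*} [MeasurableSpace α] {ν : Measure α} {u w : α → ℝ}
    (hu0 : ∀ᵐ e ∂ν, 0 ≤ u e) (hu : Integrable u ν)
    (hul : Integrable (fun e => negMulLog (u e)) ν) (hw0 : ∀ e, 0 < w e) (hw : Integrable w ν)
    (huw : Integrable (fun e => u e * log (w e)) ν) :
    ∫ e, negMulLog (u e) ∂ν + ∫ e, u e * log (w e) ∂ν ≤
      negMulLog (∫ e, u e ∂ν) + (∫ e, u e ∂ν) * (∫ e, w e ∂ν - 1) := by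
  set c := ∫ e, u e ∂ν with hc
  have hc0 : 0 ≤ c := integral_nonneg_of_ae hu0
  rcases hc0.eq_or_lt with h0 | h0
  · have hz : u =ᵐ[ν] 0 := (integral_eq_zero_iff_of_nonneg_ae hu0 hu).1 (by rw [← hc, ← h0])
    have h1 : ∫ e, negMulLog (u e) ∂ν = 0 := by
      rw [integral_eq_zero_of_ae]
      filter_upwards [hz] with e he
      simp [he]
    have h2 : ∫ e, u e * log (w e) ∂ν = 0 := by
      rw [integral_eq_zero_of_ae]
      filter_upwards [hz] with e he
      simp [he]
    rw [h1, h2, ← h0]; simp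
  -- Integrate the pointwise Gibbs inequality with comparison value `c * w e`, which needs `c > 0`.
  · have key : ∫ e, (negMulLog (u e) + u e * log (w e)) ∂ν ≤
        ∫ e, (c * w e - (1 + log c) * u e) ∂ν := by
      apply integral_mono_ae (hul.add huw) ((hw.const_mul c).sub (hu.const_mul _))
      filter_upwards [hu0] with e he
      have := negMulLog_le_sub_sub_mul_log he (mul_pos h0 (hw0 e))
      rw [log_mul h0.ne' (hw0 e).ne'] at this
      simp only [Pi.add_apply, Pi.sub_apply]
      linarith
    rw [integral_add hul huw, integral_sub (hw.const_mul c) (hu.const_mul _),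
      integral_const_mul, integral_const_mul, ← hc] at key
    refine key.trans (le_of_eq ?_)
    unfold negMulLog
    ring

-- Entropies in nats and their integrability.

namespace Channel

variable {emin emax : ℝ} (C : Channel emin emax)

/-- `h(Q|e)` in natural units. -/
def condEntropyNat (e : ℝ) : ℝ := ∫ q, Real.negMulLog (C.f q e)

/-- `h(Q)` in natural units, for the input law `ν`. -/
def outputEntropyNat (ν : Measure ℝ) : ℝ := ∫ q, Real.negMulLog (C.outputDensity ν q)

theorem mul_logb_two (x : ℝ) : x * Real.logb 2 x = -(Real.negMulLog x / Real.log 2) := by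
  unfold Real.negMulLog Real.logb; ring

theorem diffEntropy_eq (g : ℝ → ℝ) :
    diffEntropy g = (∫ q, Real.negMulLog (g q)) / Real.log 2 := by
  unfold diffEntropy
  simp_rw [mul_logb_two]
  rw [integral_neg, neg_neg, integral_div]

theorem condEntropy_eq (e : ℝ) : C.condEntropy e = C.condEntropyNat e / Real.log 2 :=
  diffEntropy_eq _

theorem measurable_f_left (e : ℝ) : Measurable (fun q => C.f q e) :=
  C.measurable_f.comp (measurable_id.prodMk measurable_const)

theorem measurable_f_prod : Measurable (fun z : ℝ × ℝ => C.f z.1 z.2) := C.measurable_f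

theorem measurable_mean : Measurable C.mean := by
  have h : Measurable (fun z : ℝ × ℝ => z.2 * C.f z.2 z.1) :=
    measurable_snd.mul (C.measurable_f_prod.comp measurable_swap)
  exact h.stronglyMeasurable.integral_prod_right.measurable

theorem measurable_outputDensity (ν : Measure ℝ) [SFinite ν] :
    Measurable (C.outputDensity ν) :=
  C.measurable_f_prod.stronglyMeasurable.integral_prod_right.measurable

theorem integrable_f {e : ℝ} (he : e ∈ Icc emin emax) : Integrable (fun q => C.f q e) := by
  by_contra h
  have := C.normalised e he
  rw [integral_undef h] at this
  exact zero_ne_one this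

theorem integrable_negMulLog_f {e : ℝ} (he : e ∈ Icc emin emax) :
    Integrable (fun q => Real.negMulLog (C.f q e)) := by
  have h := (C.finite_entropy e he).const_mul (-Real.log 2)
  refine h.congr (Filter.Eventually.of_forall fun q => ?_)
  have : Real.log 2 ≠ 0 := (Real.log_pos one_lt_two).ne'
  simp only [mul_logb_two]
  field_simp

/-- The indicator function of the range of `Q`. -/
def rangeInd (q : ℝ) : ℝ := (Ioo C.qmin C.qmax).indicator (fun _ => 1) q

theorem integrable_rangeInd : Integrable C.rangeInd :=
  (integrable_indicator_iff measurableSet_Ioo).2 (integrableOn_const (by simp))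

theorem abs_negMulLog_f_le {e : ℝ} (he : e ∈ Icc emin emax) (q : ℝ) :
    |Real.negMulLog (C.f q e)| ≤ 2 * C.rangeInd q - Real.negMulLog (C.f q e) := by
  by_cases hq : q ∈ Ioo C.qmin C.qmax
  · simpa [rangeInd, hq] using abs_negMulLog_le (C.nonneg e he q)
  · simp [rangeInd, hq, C.finite_range e he q hq]

/-- Joint integrability from integrability of the sections with a uniform bound. -/
theorem integrable_prod_of_bound {ν : Measure ℝ} [IsFiniteMeasure ν] {F : ℝ × ℝ → ℝ}
    (hF : Measurable F) {M : ℝ}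
    (h : ∀ᵐ e ∂ν, Integrable (fun q => F (q, e)) ∧ ∫ q, |F (q, e)| ≤ M) :
    Integrable F (volume.prod ν) := by
  rw [integrable_prod_iff' hF.aestronglyMeasurable]
  refine ⟨h.mono fun e he => he.1, ?_⟩
  refine Integrable.of_bound (C := M) ?_ (h.mono fun e he => ?_)
  · have h2 : Measurable (fun z : ℝ × ℝ => ‖F (z.2, z.1)‖) := (hF.comp measurable_swap).norm
    exact h2.stronglyMeasurable.integral_prod_right.aestronglyMeasurable
  · rw [Real.norm_of_nonneg (integral_nonneg fun q => norm_nonneg _)]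
    exact he.2

section Input

variable {ν : Measure ℝ}

theorem outputDensity_nonneg (hν : ∀ᵐ e ∂ν, e ∈ Icc emin emax) (q : ℝ) : 0 ≤ C.outputDensity ν q :=
  integral_nonneg_of_ae (hν.mono fun e he => C.nonneg e he q)

theorem outputDensity_eq_zero (hν : ∀ᵐ e ∂ν, e ∈ Icc emin emax)
    {q : ℝ} (hq : q ∉ Ioo C.qmin C.qmax) : C.outputDensity ν q = 0 :=
  integral_eq_zero_of_ae (hν.mono fun e he => C.finite_range e he q hq)

variable [IsFiniteMeasure ν]

theorem integrable_prod_f (hν : ∀ᵐ e ∂ν, e ∈ Icc emin emax) :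
    Integrable (fun z : ℝ × ℝ => C.f z.1 z.2) (volume.prod ν) := by
  refine integrable_prod_of_bound C.measurable_f_prod (M := 1) (hν.mono fun e he => ?_)
  refine ⟨C.integrable_f he, ?_⟩
  simp only [abs_of_nonneg (C.nonneg e he _), C.normalised e he, le_refl]

theorem integrable_outputDensity (hν : ∀ᵐ e ∂ν, e ∈ Icc emin emax) :
    Integrable (C.outputDensity ν) :=
  (C.integrable_prod_f hν).integral_prod_left

theorem integral_mul_outputDensity {φ : ℝ → ℝ}
    (h : Integrable (fun z : ℝ × ℝ => φ z.1 * C.f z.1 z.2) (volume.prod ν)) :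
    ∫ q, φ q * C.outputDensity ν q = ∫ e, ∫ q, φ q * C.f q e ∂volume ∂ν := by
  have := integral_integral_swap (f := fun q e => φ q * C.f q e) h
  rw [← this]
  simp only [integral_const_mul, outputDensity]

theorem integral_outputDensity (hν : ∀ᵐ e ∂ν, e ∈ Icc emin emax) :
    ∫ q, C.outputDensity ν q = ν.real univ := by
  have h := integral_integral_swap (f := fun q e => C.f q e) (C.integrable_prod_f hν)
  simp only [outputDensity]
  rw [h, integral_congr_ae (g := fun _ => (1 : ℝ)) (hν.mono fun e he => C.normalised e he)]
  simp

theorem integrable_prod_negMulLog (hν : ∀ᵐ e ∂ν, e ∈ Icc emin emax)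
    {l : ℝ} (hl : ∀ e ∈ Icc emin emax, l ≤ C.condEntropyNat e) :
    Integrable (fun z : ℝ × ℝ => Real.negMulLog (C.f z.1 z.2)) (volume.prod ν) := by
  refine integrable_prod_of_bound
    (Real.continuous_negMulLog.measurable.comp C.measurable_f_prod)
    (M := 2 * (∫ q, C.rangeInd q) - l) (hν.mono fun e he => ⟨C.integrable_negMulLog_f he, ?_⟩)
  have hi := C.integrable_negMulLog_f he
  calc ∫ q, |Real.negMulLog (C.f q e)|
      ≤ ∫ q, (2 * C.rangeInd q - Real.negMulLog (C.f q e)) :=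
        integral_mono hi.abs ((C.integrable_rangeInd.const_mul 2).sub hi)
          (fun q => C.abs_negMulLog_f_le he q)
    _ = 2 * (∫ q, C.rangeInd q) - C.condEntropyNat e := by
        rw [integral_sub (C.integrable_rangeInd.const_mul 2) hi, integral_const_mul]; rfl
    _ ≤ _ := by linarith [hl e he]

theorem integrable_condEntropyNat (hν : ∀ᵐ e ∂ν, e ∈ Icc emin emax)
    {l : ℝ} (hl : ∀ e ∈ Icc emin emax, l ≤ C.condEntropyNat e) :
    Integrable C.condEntropyNat ν :=
  (C.integrable_prod_negMulLog hν hl).integral_prod_right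

theorem integrable_negMulLog_outputDensity (hν : ∀ᵐ e ∂ν, e ∈ Icc emin emax) {l : ℝ}
    (hl : ∀ e ∈ Icc emin emax, l ≤ C.condEntropyNat e) :
    Integrable (fun q => Real.negMulLog (C.outputDensity ν q)) := by
  have hJ := C.integrable_prod_negMulLog hν hl
  have hf := C.integrable_prod_f hν
  have hb : Integrable (fun q => 2 * C.rangeInd q - (∫ e, Real.negMulLog (C.f q e) ∂ν)
      + C.outputDensity ν q * ν.real univ) :=
    ((C.integrable_rangeInd.const_mul 2).sub hJ.integral_prod_left).add
      ((C.integrable_outputDensity hν).mul_const _)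
  refine hb.mono' (Real.continuous_negMulLog.measurable.comp
    (C.measurable_outputDensity ν)).aestronglyMeasurable ?_
  filter_upwards [hJ.prod_right_ae, hf.prod_right_ae] with q hq1 hq2
  have hc := C.outputDensity_nonneg hν q
  rw [Real.norm_eq_abs]
  by_cases hq : q ∈ Ioo C.qmin C.qmax
  · have h1 := abs_negMulLog_le hc
    -- Jensen bounds `negMulLog` of the mixture from below by integrable functions of `q`.
    have h2 := integral_negMulLog_le (w := fun _ => 1) (hν.mono fun e he => C.nonneg e he q)
      hq2 hq1 (fun _ => one_pos) (integrable_const _) (by simp)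
    simp only [Real.log_one, mul_zero, integral_zero, integral_const, smul_eq_mul, mul_one] at h2
    change _ ≤ Real.negMulLog (C.outputDensity ν q) + C.outputDensity ν q * _ at h2
    simp only [rangeInd, hq, indicator_of_mem]
    nlinarith
  · have h0 : ∫ e, Real.negMulLog (C.f q e) ∂ν = 0 :=
      integral_eq_zero_of_ae (hν.mono fun e he => by simp [C.finite_range e he q hq])
    simp [C.outputDensity_eq_zero hν hq, rangeInd, hq, h0]

end Input

-- Perturbing an optimal input law.

theorem outputDensity_smul (ν : Measure ℝ) {p : ℝ} (hp : 0 ≤ p) (q : ℝ) :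
    C.outputDensity (ENNReal.ofReal p • ν) q = p * C.outputDensity ν q := by
  simp [outputDensity, integral_smul_measure, hp]

theorem outputDensity_add {ν₁ ν₂ : Measure ℝ} [IsFiniteMeasure ν₁] [IsFiniteMeasure ν₂]
    (h₁ : ∀ᵐ e ∂ν₁, e ∈ Icc emin emax) (h₂ : ∀ᵐ e ∂ν₂, e ∈ Icc emin emax) :
    ∀ᵐ q, C.outputDensity (ν₁ + ν₂) q = C.outputDensity ν₁ q + C.outputDensity ν₂ q := by
  filter_upwards [(C.integrable_prod_f h₁).prod_right_ae, (C.integrable_prod_f h₂).prod_right_ae]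
    with q hq1 hq2
  exact integral_add_measure hq1 hq2

theorem outputEntropyNat_add_le {l : ℝ} (hl : ∀ e ∈ Icc emin emax, l ≤ C.condEntropyNat e)
    {ν₁ ν₂ : Measure ℝ} [IsFiniteMeasure ν₁] [IsFiniteMeasure ν₂]
    (h₁ : ∀ᵐ e ∂ν₁, e ∈ Icc emin emax) (h₂ : ∀ᵐ e ∂ν₂, e ∈ Icc emin emax) :
    C.outputEntropyNat (ν₁ + ν₂) ≤ C.outputEntropyNat ν₁ + C.outputEntropyNat ν₂ := by
  have h12 : ∀ᵐ e ∂(ν₁ + ν₂), e ∈ Icc emin emax := by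
    rw [ae_add_measure_iff]; exact ⟨h₁, h₂⟩
  have i1 := C.integrable_negMulLog_outputDensity h₁ hl
  have i2 := C.integrable_negMulLog_outputDensity h₂ hl
  unfold outputEntropyNat
  rw [← integral_add i1 i2]
  refine integral_mono_ae (C.integrable_negMulLog_outputDensity h12 hl) (i1.add i2) ?_
  filter_upwards [C.outputDensity_add h₁ h₂] with q hq
  simp only [hq]
  exact negMulLog_add_le (C.outputDensity_nonneg h₁ q) (C.outputDensity_nonneg h₂ q)

/-- Concavity of entropy with weights `1 - p` and `p`. Here `ν₁` is left unnormalised, and rescaling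
it costs `(1 - p) log (1 - p) ≥ -p`, whence the term `-p`. -/
theorem le_outputEntropyNat_add_smul {l : ℝ} (hl : ∀ e ∈ Icc emin emax, l ≤ C.condEntropyNat e)
    {ν₁ ν₂ : Measure ℝ} [IsFiniteMeasure ν₁] [IsProbabilityMeasure ν₂]
    (h₁ : ∀ᵐ e ∂ν₁, e ∈ Icc emin emax) (h₂ : ∀ᵐ e ∂ν₂, e ∈ Icc emin emax)
    {p : ℝ} (hp0 : 0 ≤ p) (hp : ν₁.real univ = 1 - p) :
    C.outputEntropyNat ν₁ - p + p * C.outputEntropyNat ν₂ ≤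
      C.outputEntropyNat (ν₁ + ENNReal.ofReal p • ν₂) := by
  have hp1 : p ≤ 1 := by linarith [measureReal_nonneg (μ := ν₁) (s := univ)]
  have h2' : ∀ᵐ e ∂(ENNReal.ofReal p • ν₂), e ∈ Icc emin emax := Measure.ae_smul_measure h₂ _
  have : IsFiniteMeasure (ENNReal.ofReal p • ν₂) := Measure.smul_finite _ (by simp)
  have h12 : ∀ᵐ e ∂(ν₁ + ENNReal.ofReal p • ν₂), e ∈ Icc emin emax := by
    rw [ae_add_measure_iff]; exact ⟨h₁, h2'⟩
  have i1 := C.integrable_negMulLog_outputDensity h₁ hl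
  have i2 := C.integrable_negMulLog_outputDensity h₂ hl
  have i3 := C.integrable_outputDensity h₁
  have key : ∫ q, (Real.negMulLog (C.outputDensity ν₁ q) + C.outputDensity ν₁ q * Real.log (1 - p)
      + p * Real.negMulLog (C.outputDensity ν₂ q)) ≤
      C.outputEntropyNat (ν₁ + ENNReal.ofReal p • ν₂) := by
    refine integral_mono_ae ((i1.add (i3.mul_const _)).add (i2.const_mul _))
      (C.integrable_negMulLog_outputDensity h12 hl) ?_
    filter_upwards [C.outputDensity_add h₁ h2'] with q hq
    simp only [hq, C.outputDensity_smul ν₂ hp0]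
    refine add_mul_negMulLog_le (C.outputDensity_nonneg h₁ q) (C.outputDensity_nonneg h₂ q) hp0 hp1
      fun h => ?_
    have hz : ν₁ = 0 := by
      rw [← Measure.measure_univ_eq_zero, ← measureReal_eq_zero_iff, hp, h, sub_self]
    simp [hz, outputDensity]
  have i4 : Integrable (fun q => Real.negMulLog (C.outputDensity ν₁ q) +
      C.outputDensity ν₁ q * Real.log (1 - p)) := i1.add (i3.mul_const _)
  rw [integral_add i4 (i2.const_mul _), integral_add i1 (i3.mul_const _),
    integral_mul_const, integral_const_mul, C.integral_outputDensity h₁, hp] at key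
  have hlog : -p ≤ (1 - p) * Real.log (1 - p) := by
    have := negMulLog_le_sub_sub_mul_log (u := 1 - p) (w := 1) (by linarith) one_pos
    simp [Real.negMulLog] at this
    linarith
  unfold outputEntropyNat at *
  linarith

theorem mutualInfo_eq {l : ℝ} (hl : ∀ e ∈ Icc emin emax, l ≤ C.condEntropyNat e)
    {ν : Measure ℝ} [IsProbabilityMeasure ν] (hν : ∀ᵐ e ∂ν, e ∈ Icc emin emax) :
    C.mutualInfo ν =
      (C.outputEntropyNat ν - ∫ e, C.condEntropyNat e ∂ν) / Real.log 2 := by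
  have hi := C.integrable_condEntropyNat hν hl
  unfold mutualInfo
  simp only [diffEntropy_eq, condEntropy_eq]
  rw [integral_sub (integrable_const _) (hi.div_const _), integral_div]
  simp [outputEntropyNat, sub_div, integral_div]

/-- If an optimal law is changed by replacing a part `ν₂` by a law `ν₀` of the same mass, the
mutual information does not increase. -/
theorem optimal_replace {l : ℝ} (hl : ∀ e ∈ Icc emin emax, l ≤ C.condEntropyNat e)
    {ν₁ ν₂ ν₀ : Measure ℝ} [IsFiniteMeasure ν₁] [IsFiniteMeasure ν₂] [IsProbabilityMeasure ν₀]
    [IsProbabilityMeasure (ν₁ + ν₂)]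
    (h₁ : ∀ᵐ e ∂ν₁, e ∈ Icc emin emax) (h₂ : ∀ᵐ e ∂ν₂, e ∈ Icc emin emax)
    (h₀ : ∀ᵐ e ∂ν₀, e ∈ Icc emin emax) (ha₀ : ν₀ ≪ volume)
    (hopt : C.IsInfoMaximising C.densityLaws (ν₁ + ν₂) ∨
      C.IsInfoMaximising C.allLaws (ν₁ + ν₂)) :
    ν₂.real univ * (C.outputEntropyNat ν₀ - ∫ e, C.condEntropyNat e ∂ν₀) - ν₂.real univ ≤
      C.outputEntropyNat ν₂ - ∫ e, C.condEntropyNat e ∂ν₂ := by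
  set p := ν₂.real univ with hp
  have hp0 : 0 ≤ p := measureReal_nonneg
  have hs : ν₁.real univ = 1 - p := by
    have := measureReal_add_apply (μ₁ := ν₁) (μ₂ := ν₂) (s := univ)
    rw [probReal_univ] at this
    linarith
  have hp1 : p ≤ 1 := by linarith [measureReal_nonneg (μ := ν₁) (s := univ)]
  have h0' : ∀ᵐ e ∂(ENNReal.ofReal p • ν₀), e ∈ Icc emin emax := Measure.ae_smul_measure h₀ _
  have : IsFiniteMeasure (ENNReal.ofReal p • ν₀) := Measure.smul_finite _ (by simp)
  have h12 : ∀ᵐ e ∂(ν₁ + ν₂), e ∈ Icc emin emax := by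
    rw [ae_add_measure_iff]; exact ⟨h₁, h₂⟩
  have h10 : ∀ᵐ e ∂(ν₁ + ENNReal.ofReal p • ν₀), e ∈ Icc emin emax := by
    rw [ae_add_measure_iff]; exact ⟨h₁, h0'⟩
  have hprob : IsProbabilityMeasure (ν₁ + ENNReal.ofReal p • ν₀) := by
    constructor
    have h1 : ν₁ univ = ENNReal.ofReal (1 - p) := by
      rw [← hs, ofReal_measureReal]
    simp only [Measure.coe_add, Measure.coe_smul, Pi.add_apply, Pi.smul_apply, measure_univ,
      smul_eq_mul, mul_one, h1]
    rw [← ENNReal.ofReal_add (by linarith) hp0]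
    simp
  have hmem : (ν₁ + ENNReal.ofReal p • ν₀) ∈ C.allLaws := ⟨hprob, h10⟩
  have hle : C.mutualInfo (ν₁ + ENNReal.ofReal p • ν₀) ≤ C.mutualInfo (ν₁ + ν₂) := by
    rcases hopt with h | h
    -- The competitor stays in the class of laws with a density: `ν₁` is dominated by the optimal
    -- law, and `ν₀` is absolutely continuous.
    · refine h.2 ⟨hmem, ?_⟩
      have h3 : ν₁ ≪ volume :=
        (Measure.absolutelyContinuous_of_le (Measure.le_add_right le_rfl)).trans h.1.2
      exact h3.add_left (ha₀.smul_left _)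
    · exact h.2 hmem
  rw [C.mutualInfo_eq hl h10, C.mutualInfo_eq hl h12,
    div_le_div_iff_of_pos_right (Real.log_pos one_lt_two),
    integral_add_measure (C.integrable_condEntropyNat h₁ hl) (C.integrable_condEntropyNat h₂ hl),
    integral_add_measure (C.integrable_condEntropyNat h₁ hl)
      (C.integrable_condEntropyNat h0' hl), integral_smul_measure, ENNReal.toReal_ofReal hp0,
    smul_eq_mul] at hle
  have a := C.outputEntropyNat_add_le hl h₁ h₂
  have b := C.le_outputEntropyNat_add_smul hl h₁ h₀ hp0 hs
  linarith

end Channel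

-- Conditional means and variances.

namespace Channel

variable {emin emax : ℝ} (C : Channel emin emax)

theorem integrable_mul_f {e : ℝ} (he : e ∈ Icc emin emax) {φ : ℝ → ℝ} (hφ : Measurable φ) {D : ℝ}
    (hD : ∀ q ∈ Ioo C.qmin C.qmax, |φ q| ≤ D) : Integrable (fun q => φ q * C.f q e) := by
  refine ((C.integrable_f he).const_mul D).mono'
    (hφ.mul (C.measurable_f_left e)).aestronglyMeasurable (Filter.Eventually.of_forall fun q => ?_)
  rw [Real.norm_eq_abs, abs_mul, abs_of_nonneg (C.nonneg e he q)]
  by_cases hq : q ∈ Ioo C.qmin C.qmax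
  · exact mul_le_mul_of_nonneg_right (hD q hq) (C.nonneg e he q)
  · simp [C.finite_range e he q hq]

theorem integrable_prod_mul_f {ν : Measure ℝ} [IsFiniteMeasure ν]
    (hν : ∀ᵐ e ∂ν, e ∈ Icc emin emax) {φ : ℝ × ℝ → ℝ} (hφ : Measurable φ) {D : ℝ}
    (hD : ∀ q ∈ Ioo C.qmin C.qmax, ∀ e ∈ Icc emin emax, |φ (q, e)| ≤ D) :
    Integrable (fun z : ℝ × ℝ => φ z * C.f z.1 z.2) (volume.prod ν) := by
  refine ((C.integrable_prod_f hν).const_mul D).mono'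
    (hφ.mul C.measurable_f_prod).aestronglyMeasurable ?_
  filter_upwards [Measure.quasiMeasurePreserving_snd.ae hν] with z hz
  rw [Real.norm_eq_abs, abs_mul, abs_of_nonneg (C.nonneg z.2 hz z.1)]
  by_cases hq : z.1 ∈ Ioo C.qmin C.qmax
  · exact mul_le_mul_of_nonneg_right (hD z.1 hq z.2 hz) (C.nonneg z.2 hz z.1)
  · simp [C.finite_range z.2 hz z.1 hq]

theorem abs_sub_le_of_mem_range {q : ℝ} (hq : q ∈ Ioo C.qmin C.qmax) (c : ℝ) :
    |q - c| ≤ |C.qmin - c| + |C.qmax - c| := by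
  rw [abs_le]
  constructor
  · linarith [neg_abs_le (C.qmin - c), abs_nonneg (C.qmax - c), hq.1]
  · linarith [le_abs_self (C.qmax - c), abs_nonneg (C.qmin - c), hq.2]

theorem sq_sub_le_of_mem_range {q : ℝ} (hq : q ∈ Ioo C.qmin C.qmax) (c : ℝ) :
    |(q - c) ^ 2| ≤ (|C.qmin - c| + |C.qmax - c|) ^ 2 := by
  rw [abs_pow]
  exact pow_le_pow_left₀ (abs_nonneg _) (C.abs_sub_le_of_mem_range hq c) 2

theorem integrable_id_mul_f {e : ℝ} (he : e ∈ Icc emin emax) :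
    Integrable (fun q => q * C.f q e) :=
  C.integrable_mul_f he measurable_id
    (fun q hq => by simpa using C.abs_sub_le_of_mem_range hq 0)

theorem integrable_sq_mul_f {e : ℝ} (he : e ∈ Icc emin emax) (c : ℝ) :
    Integrable (fun q => (q - c) ^ 2 * C.f q e) :=
  C.integrable_mul_f he ((measurable_id.sub_const c).pow_const 2)
    (fun _ hq => C.sq_sub_le_of_mem_range hq c)

theorem mean_mem {e : ℝ} (he : e ∈ Icc emin emax) : C.mean e ∈ Icc C.qmin C.qmax := by
  have hi := C.integrable_f he
  have key : ∀ c : ℝ, ∫ q, c * C.f q e = c := fun c => by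
    rw [integral_const_mul, C.normalised e he, mul_one]
  constructor
  · rw [← key C.qmin]
    refine integral_mono (hi.const_mul _) (C.integrable_id_mul_f he) fun q => ?_
    by_cases hq : q ∈ Ioo C.qmin C.qmax
    · exact mul_le_mul_of_nonneg_right hq.1.le (C.nonneg e he q)
    · simp [C.finite_range e he q hq]
  · rw [← key C.qmax]
    refine integral_mono (C.integrable_id_mul_f he) (hi.const_mul _) fun q => ?_
    by_cases hq : q ∈ Ioo C.qmin C.qmax
    · exact mul_le_mul_of_nonneg_right hq.2.le (C.nonneg e he q)
    · simp [C.finite_range e he q hq]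

theorem sq_sd {e : ℝ} (he : e ∈ Icc emin emax) :
    C.sd e ^ 2 = ∫ q, (q - C.mean e) ^ 2 * C.f q e :=
  Real.sq_sqrt (integral_nonneg fun q => mul_nonneg (sq_nonneg _) (C.nonneg e he q))

theorem integral_sq_sub_mul_f {e : ℝ} (he : e ∈ Icc emin emax) (c : ℝ) :
    ∫ q, (q - c) ^ 2 * C.f q e = C.sd e ^ 2 + (C.mean e - c) ^ 2 := by
  set m := C.mean e with hm
  have i1 := C.integrable_sq_mul_f he m
  have i2 := C.integrable_id_mul_f he
  have i3 := C.integrable_f he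
  have h : ∀ q, (q - c) ^ 2 * C.f q e = ((q - m) ^ 2 * C.f q e + 2 * (m - c) * (q * C.f q e))
      + ((m - c) ^ 2 - 2 * (m - c) * m) * C.f q e := fun q => by ring
  have i4 : Integrable (fun q => (q - m) ^ 2 * C.f q e + 2 * (m - c) * (q * C.f q e)) :=
    i1.add (i2.const_mul _)
  simp_rw [h]
  rw [integral_add i4 (i3.const_mul _), integral_add i1 (i2.const_mul _), integral_const_mul,
    integral_const_mul, C.normalised e he, ← C.sq_sd he]
  change _ + _ * m + _ = _
  ring

theorem sd_pos {e : ℝ} (he : e ∈ Icc emin emax) : 0 < C.sd e := by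
  refine (Real.sqrt_nonneg _).lt_of_ne fun h => ?_
  have h2 : ∫ q, (q - C.mean e) ^ 2 * C.f q e = 0 := by rw [← C.sq_sd he]; simp [sd, ← h]
  rw [integral_eq_zero_iff_of_nonneg (fun q => mul_nonneg (sq_nonneg _) (C.nonneg e he q))
    (C.integrable_sq_mul_f he _)] at h2
  have h3 : ∫ q, C.f q e = 0 := by
    apply integral_eq_zero_of_ae
    -- Zero variance would put all the mass at one point, which is Lebesgue-null.
    have : ∀ᵐ q : ℝ, q ≠ C.mean e := by simp [ae_iff]
    filter_upwards [h2, this] with q hq hne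
    simpa [sub_ne_zero.2 hne] using hq
  rw [C.normalised e he] at h3
  exact one_ne_zero h3

end Channel

-- The Cauchy kernel, whose primitive is an arctangent and whose logarithm has a quadratic lower
-- bound.

open Real

/-- The Cauchy density of scale `s`. -/
def cauchyKernel (s x : ℝ) : ℝ := (π * s)⁻¹ * (1 + (x / s) ^ 2)⁻¹

theorem cauchyKernel_pos {s : ℝ} (hs : 0 < s) (x : ℝ) : 0 < cauchyKernel s x := by
  unfold cauchyKernel; positivity

theorem measurable_cauchyKernel (s : ℝ) : Measurable (cauchyKernel s) := by
  unfold cauchyKernel; fun_prop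

theorem cauchyKernel_le {s : ℝ} (hs : 0 < s) (x : ℝ) : cauchyKernel s x ≤ (π * s)⁻¹ := by
  unfold cauchyKernel
  refine mul_le_of_le_one_right (by positivity) (inv_le_one_of_one_le₀ ?_)
  nlinarith [sq_nonneg (x / s)]

theorem log_cauchyKernel {s : ℝ} (hs : 0 < s) (x : ℝ) :
    log (cauchyKernel s x) = -log (π * s) - log (1 + (x / s) ^ 2) := by
  unfold cauchyKernel
  rw [log_mul (by positivity) (by positivity), log_inv, log_inv]; ring

theorem le_log_cauchyKernel {s : ℝ} (hs : 0 < s) (x : ℝ) :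
    -log (π * s) - (x / s) ^ 2 ≤ log (cauchyKernel s x) := by
  rw [log_cauchyKernel hs]
  have := log_le_sub_one_of_pos (by positivity : 0 < 1 + (x / s) ^ 2)
  linarith

theorem log_cauchyKernel_le {s : ℝ} (hs : 0 < s) (x : ℝ) :
    log (cauchyKernel s x) ≤ -log (π * s) := by
  rw [log_cauchyKernel hs]
  have := log_nonneg (by nlinarith [sq_nonneg (x / s)] : 1 ≤ 1 + (x / s) ^ 2)
  linarith

theorem integrable_cauchyKernel_sub {s : ℝ} (hs : 0 < s) (c : ℝ) :
    Integrable (fun q => cauchyKernel s (q - c)) :=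
  ((integrable_inv_one_add_sq.comp_div hs.ne').const_mul (π * s)⁻¹).comp_sub_right c

theorem integral_cauchyKernel_sub {s : ℝ} (hs : 0 < s) (c : ℝ) :
    ∫ q, cauchyKernel s (q - c) = 1 := by
  rw [integral_sub_right_eq_self (cauchyKernel s) c]
  unfold cauchyKernel
  rw [integral_const_mul, Measure.integral_comp_div (fun x : ℝ => (1 + x ^ 2)⁻¹) s,
    integral_univ_inv_one_add_sq, abs_of_pos hs, smul_eq_mul]
  have := pi_pos
  field_simp

theorem hasDerivAt_arctan_comp {F : ℝ → ℝ} {F' x s : ℝ} (hs : 0 < s) (q : ℝ)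
    (hF : HasDerivAt F F' x) :
    HasDerivAt (fun e => π⁻¹ * arctan ((F e - q) / s)) (F' * cauchyKernel s (F x - q)) x := by
  have h := (((hF.sub_const q).div_const s).arctan).const_mul π⁻¹
  refine h.congr_deriv ?_
  unfold cauchyKernel
  have := pi_pos
  field_simp

theorem pi_inv_mul_arctan_sub_le (x y : ℝ) : π⁻¹ * arctan x - π⁻¹ * arctan y ≤ 1 := by
  have h1 := arctan_lt_pi_div_two x
  have h2 := neg_pi_div_two_lt_arctan y
  rw [← mul_sub, inv_mul_le_iff₀ pi_pos]
  linarith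

/-- The fundamental theorem of calculus for a function with nonnegative derivative. -/
theorem integral_Ioo_of_hasDerivAt_of_nonneg {a b : ℝ} (hab : a ≤ b) {F F' : ℝ → ℝ}
    (hc : ContinuousOn F (Icc a b)) (hd : ∀ x ∈ Ioo a b, HasDerivAt F (F' x) x)
    (hn : ∀ x ∈ Ioo a b, 0 ≤ F' x) :
    IntegrableOn F' (Ioo a b) ∧ ∫ x in Ioo a b, F' x = F b - F a := by
  have hi : IntegrableOn F' (Ioc a b) :=
    intervalIntegral.integrableOn_deriv_of_nonneg hc hd hn
  refine ⟨hi.mono_set Ioo_subset_Ioc_self, ?_⟩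
  rw [← integral_Ioc_eq_integral_Ioo, ← intervalIntegral.integral_of_le hab]
  exact intervalIntegral.integral_eq_sub_of_hasDerivAt_of_le hab hc hd
    ((intervalIntegrable_iff_integrableOn_Ioc_of_le hab).2 hi)

-- Information bounds for concentrated and for spread-out input laws.

namespace Channel

variable {emin emax : ℝ} (C : Channel emin emax)

/-- An input law concentrated near one value of the conditional mean has small output entropy. -/
theorem outputEntropyNat_le {l : ℝ} (hl : ∀ e ∈ Icc emin emax, l ≤ C.condEntropyNat e)
    {ν : Measure ℝ} [IsFiniteMeasure ν] (hν : ∀ᵐ e ∂ν, e ∈ Icc emin emax) {s c : ℝ} (hs : 0 < s)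
    (hsd : ∀ e ∈ Icc emin emax, C.sd e ≤ s) (hc : ∀ᵐ e ∂ν, |C.mean e - c| ≤ s)
    (hp : 0 < ν.real univ) :
    C.outputEntropyNat ν ≤ negMulLog (ν.real univ) + ν.real univ * (log (π * s) + 2) := by
  set p := ν.real univ with hpdef
  set F := C.outputDensity ν with hF
  have hm : Measurable fun z : ℝ × ℝ => (z.1 - c) ^ 2 := by fun_prop
  have hpr := C.integrable_prod_mul_f hν hm (fun q hq _ _ => C.sq_sub_le_of_mem_range hq c)
  have i1 : Integrable F := C.integrable_outputDensity hν
  have i2 : Integrable (fun q => (q - c) ^ 2 * F q) := by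
    have := hpr.integral_prod_left
    simp only [integral_const_mul] at this
    exact this
  have i3 := (integrable_cauchyKernel_sub hs c).const_mul p
  have i4 := i1.const_mul (-1 - log p + log (π * s))
  have i5 := i2.const_mul (s ^ 2)⁻¹
  have i34 : Integrable (fun q => p * cauchyKernel s (q - c) +
    (-1 - log p + log (π * s)) * F q) := i3.add i4
  -- One `s ^ 2` comes from the variance, the other from the squared distance of the mean to `c`.
  have h2 : ∫ q, (q - c) ^ 2 * F q ≤ p * (2 * s ^ 2) := by
    rw [C.integral_mul_outputDensity hpr, hpdef, ← smul_eq_mul, ← integral_const]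
    refine integral_mono_ae hpr.integral_prod_right (integrable_const _) ?_
    filter_upwards [hν, hc] with e he hce
    simp only [C.integral_sq_sub_mul_f he]
    have h3 := pow_le_pow_left₀ (C.sd_pos he).le (hsd e he) 2
    have h4 := pow_le_pow_left₀ (abs_nonneg _) hce 2
    rw [sq_abs] at h4
    linarith
  have h1 : C.outputEntropyNat ν ≤ ∫ q, ((p * cauchyKernel s (q - c) +
      (-1 - log p + log (π * s)) * F q) + (s ^ 2)⁻¹ * ((q - c) ^ 2 * F q)) := by
    refine integral_mono (C.integrable_negMulLog_outputDensity hν hl) (i34.add i5) fun q => ?_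
    have hq := C.outputDensity_nonneg hν q
    -- The comparison density is the Cauchy kernel at `c` with the same total mass `p`.
    have h3 := negMulLog_le_sub_sub_mul_log hq (mul_pos hp (cauchyKernel_pos hs (q - c)))
    rw [log_mul hp.ne' (cauchyKernel_pos hs (q - c)).ne'] at h3
    have h4 := mul_le_mul_of_nonneg_left (le_log_cauchyKernel hs (q - c)) hq
    have h5 : C.outputDensity ν q * ((q - c) / s) ^ 2 = (s ^ 2)⁻¹ * ((q - c) ^ 2 * F q) := by
      rw [hF]; field_simp
    change _ ≤ (p * cauchyKernel s (q - c) + (-1 - log p + log (π * s)) * C.outputDensity ν q)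
      + (s ^ 2)⁻¹ * ((q - c) ^ 2 * F q)
    rw [← h5]
    linarith
  rw [integral_add i34 i5, integral_add i3 i4, integral_const_mul, integral_const_mul,
    integral_const_mul, integral_cauchyKernel_sub hs, C.integral_outputDensity hν] at h1
  have h6 := mul_le_mul_of_nonneg_left h2 (by positivity : 0 ≤ (s ^ 2)⁻¹)
  have h7 : (s ^ 2)⁻¹ * (p * (2 * s ^ 2)) = 2 * p := by field_simp
  unfold negMulLog
  linarith

/-- The input law for which the conditional mean is uniformly distributed. -/
def uniformMeanLaw : Measure ℝ :=
  (volume.restrict (Ioo emin emax)).withDensity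
    (fun e => ENNReal.ofReal (deriv C.mean e / (C.mean emax - C.mean emin)))

theorem ae_uniformMeanLaw : ∀ᵐ e ∂C.uniformMeanLaw, e ∈ Icc emin emax :=
  (withDensity_absolutelyContinuous _ _).ae_le
    ((ae_restrict_mem measurableSet_Ioo).mono fun _ h => Ioo_subset_Icc_self h)

theorem uniformMeanLaw_absolutelyContinuous : C.uniformMeanLaw ≪ volume :=
  (withDensity_absolutelyContinuous _ _).trans Measure.restrict_le_self.absolutelyContinuous

section UniformMean

variable (hE : emin ≤ emax) (hR : 0 < C.mean emax - C.mean emin)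
  (hc : ContinuousOn C.mean (Icc emin emax)) (hd : DifferentiableOn ℝ C.mean (Ioo emin emax))
  (hpos : ∀ e ∈ Ioo emin emax, 0 < deriv C.mean e)
include hE hR hc hd hpos

theorem isProbabilityMeasure_uniformMeanLaw : IsProbabilityMeasure C.uniformMeanLaw := by
  have h := integral_Ioo_of_hasDerivAt_of_nonneg hE hc
    (fun x hx => ((hd x hx).differentiableAt (Ioo_mem_nhds hx.1 hx.2)).hasDerivAt)
    (fun x hx => (hpos x hx).le)
  constructor
  rw [uniformMeanLaw, withDensity_apply _ MeasurableSet.univ, Measure.restrict_univ,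
    ← ofReal_integral_eq_lintegral_ofReal (h.1.div_const _), integral_div, h.2, div_self hR.ne',
    ENNReal.ofReal_one]
  filter_upwards [ae_restrict_mem measurableSet_Ioo] with e he
  exact div_nonneg (hpos e he).le hR.le

/-- The density `m' / R` cancels the factor `R`, leaving the derivative of `π⁻¹ arctan((m(e) - q) /
s)`, whose total increase is at most one. So this kernel is a sub-probability density relative to
the input law, an approximate posterior of `e` given `q`. -/
theorem integral_cauchyKernel_uniformMeanLaw_le {s : ℝ} (hs : 0 < s) (q : ℝ) :
    ∫ e, (C.mean emax - C.mean emin) * cauchyKernel s (C.mean e - q) ∂C.uniformMeanLaw ≤ 1 := by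
  have h := integral_Ioo_of_hasDerivAt_of_nonneg hE
    (F := fun e => π⁻¹ * arctan ((C.mean e - q) / s))
    (((continuous_arctan.comp_continuousOn ((hc.sub continuousOn_const).div_const s))).const_mul _)
    (fun x hx => hasDerivAt_arctan_comp hs q
      ((hd x hx).differentiableAt (Ioo_mem_nhds hx.1 hx.2)).hasDerivAt)
    (fun x hx => (mul_pos (hpos x hx) (cauchyKernel_pos hs _)).le)
  rw [uniformMeanLaw, integral_withDensity_eq_integral_toReal_smul
    ((measurable_deriv _).div_const _).ennreal_ofReal (by simp)]
  refine le_trans (le_of_eq ?_) ((h.2.trans_le (pi_inv_mul_arctan_sub_le _ _)))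
  refine setIntegral_congr_fun measurableSet_Ioo fun e he => ?_
  simp only [ENNReal.toReal_ofReal (div_nonneg (hpos e he).le hR.le), smul_eq_mul]
  field_simp

/-- A lower bound for the information when the conditional mean is uniformly distributed. -/
theorem le_info_uniformMeanLaw {l : ℝ} (hl : ∀ e ∈ Icc emin emax, l ≤ C.condEntropyNat e)
    {s : ℝ} (hs : 0 < s) (hsd : ∀ e ∈ Icc emin emax, C.sd e ≤ s) :
    log ((C.mean emax - C.mean emin) / (π * s)) - 1 ≤
      C.outputEntropyNat C.uniformMeanLaw - ∫ e, C.condEntropyNat e ∂C.uniformMeanLaw := by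
  set R := C.mean emax - C.mean emin with hRdef
  set ν := C.uniformMeanLaw with hνdef
  have hν : ∀ᵐ e ∂ν, e ∈ Icc emin emax := C.ae_uniformMeanLaw
  have hprob : IsProbabilityMeasure ν := C.isProbabilityMeasure_uniformMeanLaw hE hR hc hd hpos
  have hwpos : ∀ q e, 0 < R * cauchyKernel s (C.mean e - q) := fun q e =>
    mul_pos hR (cauchyKernel_pos hs _)
  have hwm : Measurable fun z : ℝ × ℝ => R * cauchyKernel s (C.mean z.2 - z.1) :=
    ((measurable_cauchyKernel s).comp
      ((C.measurable_mean.comp measurable_snd).sub measurable_fst)).const_mul R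
  have hlower : ∀ q e, log (R / (π * s)) - (s ^ 2)⁻¹ * (q - C.mean e) ^ 2 ≤
      log (R * cauchyKernel s (C.mean e - q)) := fun q e => by
    rw [log_mul hR.ne' (cauchyKernel_pos hs _).ne', log_div hR.ne' (by positivity)]
    have h1 := le_log_cauchyKernel hs (C.mean e - q)
    have h2 : ((C.mean e - q) / s) ^ 2 = (s ^ 2)⁻¹ * (q - C.mean e) ^ 2 := by field_simp; ring
    linarith
  have hupper : ∀ q e, log (R * cauchyKernel s (C.mean e - q)) ≤ log (R / (π * s)) := fun q e => by
    rw [log_mul hR.ne' (cauchyKernel_pos hs _).ne', log_div hR.ne' (by positivity)]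
    linarith [log_cauchyKernel_le hs (C.mean e - q)]
  -- A crude bound, needed only for integrability.
  have hD : ∀ q ∈ Ioo C.qmin C.qmax, ∀ e ∈ Icc emin emax,
      |log (R * cauchyKernel s (C.mean e - q))| ≤
        |log (R / (π * s))| + (s ^ 2)⁻¹ * (C.qmax - C.qmin) ^ 2 := fun q hq e he => by
    have hm := C.mean_mem he
    have h1 : (q - C.mean e) ^ 2 ≤ (C.qmax - C.qmin) ^ 2 :=
      sq_le_sq' (by linarith [hq.1, hm.2]) (by linarith [hq.2, hm.1])
    have h2 := mul_le_mul_of_nonneg_left h1 (by positivity : 0 ≤ (s ^ 2)⁻¹)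
    have h3 : 0 ≤ (s ^ 2)⁻¹ * (C.qmax - C.qmin) ^ 2 := by positivity
    rw [abs_le]
    constructor
    · linarith [hlower q e, neg_abs_le (log (R / (π * s)))]
    · linarith [hupper q e, le_abs_self (log (R / (π * s)))]
  have hJ := C.integrable_prod_negMulLog hν hl
  have hf := C.integrable_prod_f hν
  have hL : Integrable (fun z : ℝ × ℝ =>
      log (R * cauchyKernel s (C.mean z.2 - z.1)) * C.f z.1 z.2) (volume.prod ν) :=
    C.integrable_prod_mul_f hν (measurable_log.comp hwm) hD
  have h1 : ∫ q, ((∫ e, negMulLog (C.f q e) ∂ν) +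
      ∫ e, log (R * cauchyKernel s (C.mean e - q)) * C.f q e ∂ν) ≤ C.outputEntropyNat ν := by
    refine integral_mono_ae (hJ.integral_prod_left.add hL.integral_prod_left)
      (C.integrable_negMulLog_outputDensity hν hl) ?_
    filter_upwards [hJ.prod_right_ae, hf.prod_right_ae, hL.prod_right_ae] with q q1 q2 q3
    have hw : Integrable (fun e => R * cauchyKernel s (C.mean e - q)) ν := by
      refine Integrable.of_bound (C := R * (π * s)⁻¹)
        (hwm.comp (measurable_const.prodMk measurable_id)).aestronglyMeasurable
        (Filter.Eventually.of_forall fun e => ?_)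
      rw [Real.norm_of_nonneg (hwpos q e).le]
      exact mul_le_mul_of_nonneg_left (cauchyKernel_le hs _) hR.le
    -- Jensen with the approximate posterior as weight. Its integral is at most one, so the
    -- correction term is nonpositive and can be dropped.
    have h2 := integral_negMulLog_le (hν.mono fun e he => C.nonneg e he q) q2 q1 (hwpos q) hw
      (by simpa only [mul_comm] using q3)
    have h3 := C.integral_cauchyKernel_uniformMeanLaw_le hE hR hc hd hpos hs q
    have h4 := C.outputDensity_nonneg hν q
    change _ ≤ negMulLog (C.outputDensity ν q)
    change _ ≤ negMulLog (C.outputDensity ν q) + C.outputDensity ν q * _ at h2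
    simp only [mul_comm (log _)]
    nlinarith
  have e1 := integral_integral_swap (f := fun q e => negMulLog (C.f q e)) hJ
  have e2 := integral_integral_swap
    (f := fun q e => log (R * cauchyKernel s (C.mean e - q)) * C.f q e) hL
  rw [integral_add hJ.integral_prod_left hL.integral_prod_left, e1] at h1
  have h2 : log (R / (π * s)) - 1 ≤
      ∫ q, ∫ e, log (R * cauchyKernel s (C.mean e - q)) * C.f q e ∂ν := by
    rw [e2]
    have : log (R / (π * s)) - 1 = ∫ e, (log (R / (π * s)) - 1) ∂ν := by simp
    rw [this]
    refine integral_mono_ae (integrable_const _) hL.integral_prod_right ?_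
    filter_upwards [hν] with e he
    have i1 := (C.integrable_f he).const_mul (log (R / (π * s)))
    have i2 := (C.integrable_sq_mul_f he (C.mean e)).const_mul (s ^ 2)⁻¹
    have hm : Measurable fun q => log (R * cauchyKernel s (C.mean e - q)) :=
      measurable_log.comp (((measurable_cauchyKernel s).comp
        (measurable_id.const_sub (C.mean e))).const_mul R)
    have i3 := C.integrable_mul_f he hm (fun q hq => hD q hq e he)
    calc log (R / (π * s)) - 1
        ≤ log (R / (π * s)) * 1 - (s ^ 2)⁻¹ * C.sd e ^ 2 := by
          have h3 := pow_le_pow_left₀ (C.sd_pos he).le (hsd e he) 2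
          have h4 := mul_le_mul_of_nonneg_left h3 (by positivity : 0 ≤ (s ^ 2)⁻¹)
          rw [inv_mul_cancel₀ (by positivity)] at h4
          linarith
      _ = ∫ q, (log (R / (π * s)) * C.f q e - (s ^ 2)⁻¹ * ((q - C.mean e) ^ 2 * C.f q e)) := by
          rw [integral_sub i1 i2, integral_const_mul, integral_const_mul, C.normalised e he,
            ← C.sq_sd he]
      _ ≤ ∫ q, log (R * cauchyKernel s (C.mean e - q)) * C.f q e := by
          refine integral_mono (i1.sub i2) i3 fun q => ?_
          have := mul_le_mul_of_nonneg_right (hlower q e) (C.nonneg e he q)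
          linarith
  change (∫ e, C.condEntropyNat e ∂ν) + _ ≤ _ at h1
  linarith

end UniformMean

end Channel

/-- Averaging the Cauchy kernel against a measure whose mass on every window of radius one is
at most `D`. -/
theorem integral_inv_one_add_sq_le {α : Type*} [MeasurableSpace α] {ν : Measure α}
    [IsFiniteMeasure ν] {g : α → ℝ} (hg : Measurable g) {D : ℝ}
    (hD : ∀ u, ν.real {e | |g e - u| ≤ 1} ≤ D) :
    ∫ e, (1 + g e ^ 2)⁻¹ ∂ν ≤ 3 / 2 * (π * D) := by
  have hS : MeasurableSet {z : ℝ × α | |g z.2 - z.1| ≤ 1} :=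
    measurableSet_le (((hg.comp measurable_snd).sub measurable_fst).abs) measurable_const
  -- The profile at `g e` is compared with its integral over the unit window around `g e`;
  -- exchanging the integrals turns windows in `u` into windows in `e`.
  set k : ℝ → α → ℝ := fun u e => {z : ℝ × α | |g z.2 - z.1| ≤ 1}.indicator
    (fun z => (1 + z.1 ^ 2)⁻¹) (u, e) with hk
  have hkm : Measurable (fun z : ℝ × α => k z.1 z.2) := by
    have : Measurable fun z : ℝ × α => (1 + z.1 ^ 2)⁻¹ := by fun_prop
    exact this.indicator hS
  have hki : Integrable (fun z : ℝ × α => k z.1 z.2) (volume.prod ν) := by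
    refine (integrable_inv_one_add_sq.comp_fst ν).mono' hkm.aestronglyMeasurable
      (Filter.Eventually.of_forall fun z => ?_)
    have h0 : 0 ≤ (1 + z.1 ^ 2)⁻¹ := by positivity
    rw [Real.norm_eq_abs]
    by_cases hz : |g z.2 - z.1| ≤ 1
    · simp [hk, hz, abs_of_nonneg h0]
    · simp [hk, hz, h0]
  have hpt : ∀ e, (1 + g e ^ 2)⁻¹ ≤ 3 / 2 * ∫ u, k u e := fun e => by
    have hke : (fun u => k u e) = (Icc (g e - 1) (g e + 1)).indicator (fun u => (1 + u ^ 2)⁻¹) := by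
      ext u
      have : |g e - u| ≤ 1 ↔ u ∈ Icc (g e - 1) (g e + 1) := by
        rw [abs_le, mem_Icc]; constructor <;> rintro ⟨h1, h2⟩ <;> constructor <;> linarith
      by_cases hu : |g e - u| ≤ 1
      · rw [indicator_of_mem (this.1 hu)]; simp [hk, hu]
      · rw [indicator_of_notMem (fun h => hu (this.2 h))]; simp [hk, hu]
    rw [hke, integral_indicator measurableSet_Icc]
    have hlow : ∫ _ in Icc (g e - 1) (g e + 1), (3 * (1 + g e ^ 2))⁻¹ ≤
        ∫ u in Icc (g e - 1) (g e + 1), (1 + u ^ 2)⁻¹ := by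
      refine setIntegral_mono_on (integrableOn_const (by simp))
        integrable_inv_one_add_sq.integrableOn measurableSet_Icc fun u hu => ?_
      refine inv_anti₀ (by positivity) ?_
      -- For `|u - g| ≤ 1`, `1 + u² ≤ 3 + 2g² ≤ 3(1 + g²)`. With window length 2 this gives the
      -- factor `3 / 2`.
      nlinarith [sq_nonneg (2 * g e - u), mul_nonneg (sub_nonneg.2 hu.1) (sub_nonneg.2 hu.2),
        sq_nonneg (g e)]
    rw [setIntegral_const, Real.volume_real_Icc_of_le (by linarith), smul_eq_mul] at hlow
    have h2 : 3 / 2 * ((g e + 1 - (g e - 1)) * (3 * (1 + g e ^ 2))⁻¹) = (1 + g e ^ 2)⁻¹ := by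
      have : 0 < 1 + g e ^ 2 := by positivity
      field_simp
      ring
    linarith
  have hwin : ∀ u, ∫ e, k u e ∂ν = (1 + u ^ 2)⁻¹ * ν.real {e | |g e - u| ≤ 1} := fun u => by
    have hm : MeasurableSet {e | |g e - u| ≤ 1} :=
      measurableSet_le (hg.sub_const u).abs measurable_const
    have : (fun e => k u e) = {e | |g e - u| ≤ 1}.indicator (fun _ => (1 + u ^ 2)⁻¹) := by
      ext e
      by_cases he : |g e - u| ≤ 1 <;> simp [hk, he]
    rw [this, integral_indicator hm, setIntegral_const, smul_eq_mul, mul_comm]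
  have hgi : Integrable (fun e => (1 + g e ^ 2)⁻¹) ν := by
    refine Integrable.of_bound (C := 1) (by fun_prop) (Filter.Eventually.of_forall fun e => ?_)
    rw [Real.norm_of_nonneg (by positivity)]
    exact inv_le_one_of_one_le₀ (by nlinarith [sq_nonneg (g e)])
  calc ∫ e, (1 + g e ^ 2)⁻¹ ∂ν ≤ ∫ e, 3 / 2 * (∫ u, k u e) ∂ν :=
        integral_mono hgi (hki.integral_prod_right.const_mul _) hpt
    _ = 3 / 2 * ∫ u, (1 + u ^ 2)⁻¹ * ν.real {e | |g e - u| ≤ 1} := by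
        rw [integral_const_mul, ← integral_integral_swap hki]
        simp_rw [hwin]
    _ ≤ 3 / 2 * ∫ u, (1 + u ^ 2)⁻¹ * D := by
        refine mul_le_mul_of_nonneg_left ?_ (by norm_num)
        refine integral_mono ?_ (integrable_inv_one_add_sq.mul_const D) fun u =>
          mul_le_mul_of_nonneg_left (hD u) (by positivity)
        exact hki.integral_prod_left.congr (Filter.Eventually.of_forall hwin)
    _ = 3 / 2 * (π * D) := by rw [integral_mul_const, integral_univ_inv_one_add_sq]

-- Comparability of the standard deviations and the window bound.

namespace Channel

variable {emin emax : ℝ} (C : Channel emin emax)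

theorem sd_le_sdMax (hc : ContinuousOn C.sd (Icc emin emax)) {e : ℝ} (he : e ∈ Icc emin emax) :
    C.sd e ≤ C.sdMax :=
  le_csSup (isCompact_Icc.bddAbove_image hc) (mem_image_of_mem _ he)

/-- A standard deviation that changes slowly is comparable with its maximum. -/
theorem log_sdMax_le {L : ℝ} (hE : emin < emax) (hc : ContinuousOn C.sd (Icc emin emax))
    (hd : DifferentiableOn ℝ C.sd (Ioo emin emax))
    (hL : ∀ e ∈ Ioo emin emax, |deriv C.sd e| ≤ L * C.sd e) {e : ℝ} (he : e ∈ Icc emin emax) :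
    log C.sdMax ≤ log (C.sd e) + L * (emax - emin) := by
  have hL0 : 0 ≤ L := by
    have hm : (emin + emax) / 2 ∈ Ioo emin emax := ⟨by linarith, by linarith⟩
    have h1 := (abs_nonneg _).trans (hL _ hm)
    exact nonneg_of_mul_nonneg_left h1 (C.sd_pos (Ioo_subset_Icc_self hm))
  have hcl : ContinuousOn (fun x => log (C.sd x)) (Icc emin emax) :=
    hc.log fun x hx => (C.sd_pos hx).ne'
  have hder : ∀ x ∈ Ioo emin emax,
      HasDerivAt (fun x => log (C.sd x)) (deriv C.sd x / C.sd x) x := fun x hx =>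
    (((hd x hx).differentiableAt (Ioo_mem_nhds hx.1 hx.2)).hasDerivAt).log
      (C.sd_pos (Ioo_subset_Icc_self hx)).ne'
  have hbd : ∀ x ∈ Ioo emin emax, |deriv (fun x => log (C.sd x)) x| ≤ L := fun x hx => by
    have hp := C.sd_pos (Ioo_subset_Icc_self hx)
    rw [(hder x hx).deriv, abs_div, abs_of_pos hp, div_le_iff₀ hp]
    exact hL x hx
  have hdl : DifferentiableOn ℝ (fun x => log (C.sd x)) (interior (Icc emin emax)) := by
    rw [interior_Icc]
    exact fun x hx => (hder x hx).differentiableAt.differentiableWithinAt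
  have hcmp : ∀ x ∈ Icc emin emax, log (C.sd x) ≤ log (C.sd e) + L * (emax - emin) := by
    intro x hx
    rcases le_total e x with h | h
    · have h1 := (convex_Icc emin emax).image_sub_le_mul_sub_of_deriv_le hcl hdl (C := L)
        (fun y hy => (abs_le.1 (hbd y (by rwa [interior_Icc] at hy))).2) e he x hx h
      nlinarith [hx.2, he.1]
    · have h1 := (convex_Icc emin emax).mul_sub_le_image_sub_of_le_deriv hcl hdl (C := -L)
        (fun y hy => (abs_le.1 (hbd y (by rwa [interior_Icc] at hy))).1) x hx e he h
      nlinarith [hx.1, he.2]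
  obtain ⟨x, hx, hxm⟩ := isCompact_Icc.exists_sSup_image_eq (nonempty_Icc.2 hE.le) hc
  rw [sdMax, hxm]
  exact hcmp x hx

/-- An optimal input law gives mass of order `s` to every window of radius `s` in the
conditional mean, where `s` bounds the conditional standard deviations. -/
theorem window_le {ρ M s : ℝ} (hE : emin ≤ emax) (hρ : 0 < ρ)
    (hR : ρ ≤ C.mean emax - C.mean emin)
    (hc : ContinuousOn C.mean (Icc emin emax)) (hd : DifferentiableOn ℝ C.mean (Ioo emin emax))
    (hpos : ∀ e ∈ Ioo emin emax, 0 < deriv C.mean e) (hs : 0 < s)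
    (hsd : ∀ e ∈ Icc emin emax, C.sd e ≤ s)
    (hl : ∀ e ∈ Icc emin emax, log s - M ≤ C.condEntropyNat e)
    {μ : Measure ℝ} [IsProbabilityMeasure μ] (hμ : ∀ᵐ e ∂μ, e ∈ Icc emin emax)
    (hopt : C.IsInfoMaximising C.densityLaws μ ∨ C.IsInfoMaximising C.allLaws μ) (c : ℝ) :
    μ.real {e | |C.mean e - c| ≤ s} ≤ π ^ 2 / ρ * exp (M + 4) * s := by
  have hR0 : 0 < C.mean emax - C.mean emin := hρ.trans_le hR
  set R := C.mean emax - C.mean emin with hRdef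
  set W : Set ℝ := {e | |C.mean e - c| ≤ s} with hW
  have hWm : MeasurableSet W :=
    measurableSet_le (C.measurable_mean.sub_const c).abs measurable_const
  have hsum := Measure.restrict_compl_add_restrict (μ := μ) hWm
  rcases (measureReal_nonneg (μ := μ) (s := W)).eq_or_lt with h0 | h0
  · rw [← h0]; positivity
  have hprob : IsProbabilityMeasure (μ.restrict Wᶜ + μ.restrict W) := by rwa [hsum]
  have hprob0 := C.isProbabilityMeasure_uniformMeanLaw hE hR0 hc hd hpos
  have h2 : ∀ᵐ e ∂μ.restrict W, e ∈ Icc emin emax := ae_restrict_of_ae hμ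
  have key := C.optimal_replace hl (ae_restrict_of_ae hμ) h2 C.ae_uniformMeanLaw
    C.uniformMeanLaw_absolutelyContinuous (by rwa [hsum])
  have hI := C.le_info_uniformMeanLaw hE hR0 hc hd hpos hl hs hsd
  have hu : (μ.restrict W).real univ = μ.real W := by simp [measureReal_def]
  have hB := C.outputEntropyNat_le hl h2 hs hsd (ae_restrict_mem hWm) (by rwa [hu])
  rw [hu] at key hB
  set p := μ.real W with hp
  have hC : p * (log s - M) ≤ ∫ e, C.condEntropyNat e ∂μ.restrict W := by
    rw [← hu, ← smul_eq_mul, ← integral_const]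
    exact integral_mono_ae (integrable_const _) (C.integrable_condEntropyNat h2 hl)
      (h2.mono fun e he => hl e he)
  have h3 := mul_le_mul_of_nonneg_left hI h0.le
  rw [log_mul pi_pos.ne' hs.ne'] at hB
  rw [log_div hR0.ne' (by positivity), log_mul pi_pos.ne' hs.ne'] at h3
  -- The 4 collects 1 from `le_info_uniformMeanLaw`, 1 from renormalising in `optimal_replace`, and
  -- 2 from the second moment in `outputEntropyNat_le`.
  have h4 : p * log p ≤ p * (log s + 2 * log π - log R + (M + 4)) := by
    unfold negMulLog at hB
    linarith
  have h5 := le_of_mul_le_mul_left h4 h0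
  have h6 : log (π ^ 2 / R * exp (M + 4) * s) = log s + 2 * log π - log R + (M + 4) := by
    rw [log_mul (by positivity) hs.ne', log_mul (by positivity) (exp_pos _).ne',
      log_div (by positivity) hR0.ne', log_exp, log_pow]
    push_cast; ring
  rw [← h6, log_le_log_iff h0 (by positivity)] at h5
  refine h5.trans ?_
  gcongr

-- Comparing the order of two outputs with that of their inputs.

/-- The conditional distribution function of `Q` given `E = e`. -/
def condCdf (q e : ℝ) : ℝ := ∫ x, (Iic q).indicator (fun _ => (1 : ℝ)) x * C.f x e

theorem indicator_one_mem (S : Set ℝ) (x : ℝ) :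
    S.indicator (fun _ => (1 : ℝ)) x ∈ Icc (0 : ℝ) 1 := by
  by_cases hx : x ∈ S <;> simp [hx]

theorem abs_indicator_one_le (S : Set ℝ) (x : ℝ) :
    |S.indicator (fun _ => (1 : ℝ)) x| ≤ 1 := by
  by_cases hx : x ∈ S <;> simp [hx]

theorem integrable_indicator_mul_f {S : Set ℝ} (hS : MeasurableSet S) {e : ℝ}
    (he : e ∈ Icc emin emax) :
    Integrable (fun x => S.indicator (fun _ => (1 : ℝ)) x * C.f x e) :=
  C.integrable_mul_f he (measurable_const.indicator hS) (fun x _ => abs_indicator_one_le S x)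

theorem measurable_condCdf : Measurable (fun z : ℝ × ℝ => C.condCdf z.1 z.2) := by
  have h : Measurable (fun w : (ℝ × ℝ) × ℝ =>
      (Iic w.1.1).indicator (fun _ => (1 : ℝ)) w.2 * C.f w.2 w.1.2) := by
    refine Measurable.mul ?_ (C.measurable_f_prod.comp
      (measurable_snd.prodMk (measurable_snd.comp measurable_fst)))
    have hS : MeasurableSet {w : (ℝ × ℝ) × ℝ | w.2 ≤ w.1.1} :=
      measurableSet_le measurable_snd (measurable_fst.comp measurable_fst)
    exact (measurable_const (a := (1 : ℝ))).indicator hS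
  exact h.stronglyMeasurable.integral_prod_right.measurable

theorem condCdf_mem {e : ℝ} (he : e ∈ Icc emin emax) (q : ℝ) : C.condCdf q e ∈ Icc (0 : ℝ) 1 := by
  constructor
  · exact integral_nonneg fun x => mul_nonneg (indicator_one_mem _ x).1 (C.nonneg e he x)
  · rw [← C.normalised e he]
    exact integral_mono (C.integrable_indicator_mul_f measurableSet_Iic he) (C.integrable_f he)
      fun x => mul_le_of_le_one_left (C.nonneg e he x) (indicator_one_mem _ x).2

theorem one_sub_condCdf {e : ℝ} (he : e ∈ Icc emin emax) (q : ℝ) :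
    1 - C.condCdf q e = ∫ x, (Ioi q).indicator (fun _ => (1 : ℝ)) x * C.f x e := by
  have h := integral_sub (C.integrable_f he) (C.integrable_indicator_mul_f measurableSet_Iic he)
    (f := fun x => C.f x e) (g := fun x => (Iic q).indicator (fun _ => (1 : ℝ)) x * C.f x e)
  rw [C.normalised e he] at h
  rw [condCdf, ← h]
  congr 1 with x
  by_cases hx : x ≤ q
  · simp [hx]
  · simp [hx, not_le.1 hx]

/-- The Chebyshev step for `Q'` with `Q = q` held fixed; it is used with `d` the squared gap of the
means and `y = (q - m(e))²`, which is averaged over `q` afterwards. -/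
theorem mul_integral_indicator_le {S : Set ℝ} (hS : MeasurableSet S) {e' : ℝ}
    (he' : e' ∈ Icc emin emax) {d y : ℝ} (h : ∀ x ∈ S, d ≤ 2 * ((x - C.mean e') ^ 2 + y))
    (hy : 0 ≤ y) :
    d * (∫ x, S.indicator (fun _ => (1 : ℝ)) x * C.f x e') ≤ 2 * (C.sd e' ^ 2 + y) := by
  have i1 := C.integrable_sq_mul_f he' (C.mean e')
  have i2 := (C.integrable_f he').const_mul y
  calc d * (∫ x, S.indicator (fun _ => (1 : ℝ)) x * C.f x e')
      = ∫ x, d * (S.indicator (fun _ => (1 : ℝ)) x * C.f x e') := (integral_const_mul _ _).symm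
    _ ≤ ∫ x, 2 * ((x - C.mean e') ^ 2 * C.f x e' + y * C.f x e') := by
        refine integral_mono ((C.integrable_indicator_mul_f hS he').const_mul _)
          ((i1.add i2).const_mul 2) fun x => ?_
        have h0 := C.nonneg e' he' x
        by_cases hx : x ∈ S
        · have := mul_le_mul_of_nonneg_right (h x hx) h0
          simp only [hx, indicator_of_mem, one_mul]
          linarith
        · simp only [hx, not_false_eq_true, indicator_of_notMem, zero_mul, mul_zero]
          positivity
    _ = 2 * (C.sd e' ^ 2 + y) := by
        rw [integral_const_mul, integral_add i1 i2, integral_const_mul, C.normalised e' he',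
          C.sq_sd he', mul_one]

/-- `P(Q' ≤ Q)`, where `Q'` and `Q` are independent outputs for the inputs `e'` and `e`. -/
def orderProb (e' e : ℝ) : ℝ := ∫ q, C.condCdf q e' * C.f q e

theorem integrable_condCdf_mul {e' e : ℝ} (he' : e' ∈ Icc emin emax) (he : e ∈ Icc emin emax) :
    Integrable (fun q => C.condCdf q e' * C.f q e) :=
  C.integrable_mul_f he (C.measurable_condCdf.comp (measurable_id.prodMk measurable_const)) (D := 1)
    fun q _ => by
      have := C.condCdf_mem he' q
      exact abs_le.2 ⟨by linarith [this.1], this.2⟩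

theorem orderProb_mem {e' e : ℝ} (he' : e' ∈ Icc emin emax) (he : e ∈ Icc emin emax) :
    C.orderProb e' e ∈ Icc (0 : ℝ) 1 := by
  constructor
  · exact integral_nonneg fun x => mul_nonneg (C.condCdf_mem he' x).1 (C.nonneg e he x)
  · rw [← C.normalised e he]
    exact integral_mono (C.integrable_condCdf_mul he' he) (C.integrable_f he)
      fun x => mul_le_of_le_one_left (C.nonneg e he x) (C.condCdf_mem he' x).2

/-- By Chebyshev's inequality, outputs are ordered like inputs with high probability. -/
theorem abs_orderProb_sub_le {s : ℝ} (hs : 0 < s) (hsd : ∀ e ∈ Icc emin emax, C.sd e ≤ s)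
    (hm : StrictMonoOn C.mean (Icc emin emax)) {e' e : ℝ} (he' : e' ∈ Icc emin emax)
    (he : e ∈ Icc emin emax) :
    |C.orderProb e' e - (Iic e).indicator (fun _ => (1 : ℝ)) e'| ≤
      5 * (1 + ((C.mean e' - C.mean e) / s) ^ 2)⁻¹ := by
  set d := C.mean e - C.mean e' with hdef
  have hT := C.orderProb_mem he' he
  have i0 := C.integrable_condCdf_mul he' he
  have i1 := C.integrable_f he
  have i2 := C.integrable_sq_mul_f he (C.mean e)
  have ibd := ((i1.const_mul (C.sd e' ^ 2)).add i2).const_mul 2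
  have hbd : ∫ q, 2 * (C.sd e' ^ 2 * C.f q e + (q - C.mean e) ^ 2 * C.f q e) ≤ 4 * s ^ 2 := by
    rw [integral_const_mul, integral_add (i1.const_mul _) i2, integral_const_mul,
      C.normalised e he, ← C.sq_sd he]
    have h1 := pow_le_pow_left₀ (C.sd_pos he).le (hsd e he) 2
    have h2 := pow_le_pow_left₀ (C.sd_pos he').le (hsd e' he') 2
    linarith
  have hcheb : d ^ 2 * |C.orderProb e' e - (Iic e).indicator (fun _ => (1 : ℝ)) e'| ≤
      4 * s ^ 2 := by
    rcases le_or_gt e' e with h | h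
    · have hd0 : 0 ≤ d := sub_nonneg.2 (hm.monotoneOn he' he h)
      have h1 : |C.orderProb e' e - (Iic e).indicator (fun _ => (1 : ℝ)) e'| =
          1 - C.orderProb e' e := by
        rw [indicator_of_mem (show e' ∈ Iic e from h), abs_sub_comm, abs_of_nonneg]
        linarith [hT.2]
      have h2 : 1 - C.orderProb e' e = ∫ q, (1 - C.condCdf q e') * C.f q e := by
        have h := integral_sub i1 i0
        rw [C.normalised e he] at h
        rw [orderProb, ← h]
        congr 1 with q
        ring
      have i3 : Integrable fun q => (1 - C.condCdf q e') * C.f q e := by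
        refine (i1.sub i0).congr (Filter.Eventually.of_forall fun q => ?_)
        simp only [Pi.sub_apply]; ring
      rw [h1, h2, ← integral_const_mul]
      refine (integral_mono (i3.const_mul _) ibd fun q => ?_).trans hbd
      have h3 := C.mul_integral_indicator_le (measurableSet_Ioi (a := q)) he' (d := d ^ 2)
        -- If outputs `x > q` are in the wrong order, the gap `m(e) - m(e')` is at most `(x - m(e'))
        -- - (q - m(e))`; then square.
        (y := (q - C.mean e) ^ 2) (fun x hx => by
          have hx' : q < x := hx
          nlinarith [sq_nonneg ((x - C.mean e') + (q - C.mean e)), sq_nonneg (x - q),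
            mul_nonneg hd0 (sub_nonneg.2 hx'.le)]) (sq_nonneg _)
      rw [← C.one_sub_condCdf he'] at h3
      have := mul_le_mul_of_nonneg_right h3 (C.nonneg e he q)
      simp only [Pi.add_apply]
      linarith
    · have hd0 : 0 ≤ -d := by linarith [hm.monotoneOn he he' h.le]
      have h1 : |C.orderProb e' e - (Iic e).indicator (fun _ => (1 : ℝ)) e'| =
          C.orderProb e' e := by
        rw [indicator_of_notMem (by simpa using h), sub_zero, abs_of_nonneg hT.1]
      rw [h1, orderProb, ← integral_const_mul]
      refine (integral_mono (i0.const_mul _) ibd fun q => ?_).trans hbd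
      have h3 := C.mul_integral_indicator_le (measurableSet_Iic (a := q)) he' (d := d ^ 2)
        (y := (q - C.mean e) ^ 2) (fun x hx => by
          have hx' : x ≤ q := hx
          nlinarith [sq_nonneg ((x - C.mean e') + (q - C.mean e)), sq_nonneg (x - q),
            mul_nonneg hd0 (sub_nonneg.2 hx')]) (sq_nonneg _)
      have := mul_le_mul_of_nonneg_right h3 (C.nonneg e he q)
      simp only [Pi.add_apply]
      change d ^ 2 * (C.condCdf q e' * C.f q e) ≤ _
      change d ^ 2 * C.condCdf q e' * C.f q e ≤ _ at this
      linarith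
  have hone : |C.orderProb e' e - (Iic e).indicator (fun _ => (1 : ℝ)) e'| ≤ 1 := by
    have := indicator_one_mem (Iic e) e'
    exact abs_le.2 ⟨by linarith [hT.1, this.2], by linarith [hT.2, this.1]⟩
  have hsq : ((C.mean e' - C.mean e) / s) ^ 2 = d ^ 2 / s ^ 2 := by
    rw [div_pow, hdef]; congr 1; ring
  -- The constant 5 is the trivial bound 1 plus the Chebyshev bound 4.
  rw [hsq, ← div_eq_mul_inv, le_div_iff₀ (by positivity), mul_add, mul_one]
  have h4 : |C.orderProb e' e - (Iic e).indicator (fun _ => (1 : ℝ)) e'| * (d ^ 2 / s ^ 2) ≤ 4 := by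
    rw [← mul_div_assoc, div_le_iff₀ (by positivity)]
    linarith
  linarith

-- From the window bound to the mean of `Q*` and the quantiles of `E`.

section Law

variable {μ : Measure ℝ} [IsProbabilityMeasure μ]

theorem cdfQ_eq (hμ : ∀ᵐ e ∂μ, e ∈ Icc emin emax) (q : ℝ) :
    C.cdfQ μ q = ∫ e', C.condCdf q e' ∂μ := by
  have hm : Measurable fun z : ℝ × ℝ => (Iic q).indicator (fun _ => (1 : ℝ)) z.1 :=
    (measurable_const.indicator measurableSet_Iic).comp measurable_fst
  have h := C.integral_mul_outputDensity (C.integrable_prod_mul_f hμ hm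
    (fun x _ _ _ => abs_indicator_one_le (Iic q) x))
  rw [cdfQ, ← integral_indicator measurableSet_Iic]
  refine Eq.trans ?_ h
  congr 1 with x
  by_cases hx : x ∈ Iic q <;> simp [hx]

theorem integrable_prod_condCdf_mul (hμ : ∀ᵐ e ∂μ, e ∈ Icc emin emax) {e : ℝ}
    (he : e ∈ Icc emin emax) :
    Integrable (fun z : ℝ × ℝ => C.condCdf z.1 z.2 * C.f z.1 e) (volume.prod μ) := by
  refine ((C.integrable_f he).comp_fst μ).mono' (C.measurable_condCdf.mul
    ((C.measurable_f_left e).comp measurable_fst)).aestronglyMeasurable ?_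
  filter_upwards [Measure.quasiMeasurePreserving_snd.ae hμ] with z hz
  have h1 := C.condCdf_mem hz z.1
  have h2 := C.nonneg e he z.1
  rw [Real.norm_of_nonneg (mul_nonneg h1.1 h2)]
  exact mul_le_of_le_one_left h2 h1.2

theorem meanQStar_eq (hμ : ∀ᵐ e ∂μ, e ∈ Icc emin emax) {e : ℝ} (he : e ∈ Icc emin emax) :
    C.meanQStar μ e = ∫ e', C.orderProb e' e ∂μ := by
  have h := integral_integral_swap (f := fun q e' => C.condCdf q e' * C.f q e)
    (C.integrable_prod_condCdf_mul hμ he)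
  simp only [orderProb, ← h, meanQStar, C.cdfQ_eq hμ, integral_mul_const]

theorem abs_meanQStar_sub_cdfE_le {s D : ℝ} (hs : 0 < s) (hsd : ∀ e ∈ Icc emin emax, C.sd e ≤ s)
    (hm : StrictMonoOn C.mean (Icc emin emax)) (hμ : ∀ᵐ e ∂μ, e ∈ Icc emin emax)
    (hD : ∀ c, μ.real {e | |C.mean e - c| ≤ s} ≤ D) {e : ℝ} (he : e ∈ Icc emin emax) :
    |C.meanQStar μ e - C.cdfE μ e| ≤ 5 * (3 / 2 * (π * D)) := by
  have hg : Measurable fun e' => (C.mean e' - C.mean e) / s :=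
    (C.measurable_mean.sub_const _).div_const s
  have hgm : Measurable fun e' => (1 + ((C.mean e' - C.mean e) / s) ^ 2)⁻¹ :=
    ((hg.pow_const 2).const_add 1).inv
  have hind : Integrable ((Iic e).indicator (fun _ => (1 : ℝ))) μ :=
    (integrable_const (1 : ℝ)).indicator measurableSet_Iic
  have hcdf : C.cdfE μ e = ∫ e', (Iic e).indicator (fun _ => (1 : ℝ)) e' ∂μ := by
    rw [integral_indicator measurableSet_Iic]; simp [cdfE]
  have hord : Integrable (fun e' => C.orderProb e' e) μ :=
    (C.integrable_prod_condCdf_mul hμ he).integral_prod_right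
  rw [C.meanQStar_eq hμ he, hcdf, ← integral_sub hord hind]
  refine abs_integral_le_integral_abs.trans ?_
  have hgi : Integrable (fun e' => 5 * (1 + ((C.mean e' - C.mean e) / s) ^ 2)⁻¹) μ := by
    refine Integrable.const_mul (Integrable.of_bound (C := 1)
      hgm.aestronglyMeasurable (Filter.Eventually.of_forall fun e' => ?_)) 5
    rw [Real.norm_of_nonneg (by positivity)]
    exact inv_le_one_of_one_le₀ (by nlinarith [sq_nonneg ((C.mean e' - C.mean e) / s)])
  calc _ ≤ ∫ e', 5 * (1 + ((C.mean e' - C.mean e) / s) ^ 2)⁻¹ ∂μ := by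
        refine integral_mono_ae (hord.sub hind).abs hgi ?_
        filter_upwards [hμ] with e' he'
        exact C.abs_orderProb_sub_le hs hsd hm he' he
    _ ≤ _ := by
        rw [integral_const_mul]
        refine mul_le_mul_of_nonneg_left (integral_inv_one_add_sq_le hg fun u => ?_) (by norm_num)
        -- A unit window in the rescaled mean is a window of radius `s` around `m(e) + s u`.
        refine le_of_eq_of_le ?_ (hD (C.mean e + s * u))
        congr 1 with e'
        have : (C.mean e' - C.mean e) / s - u = (C.mean e' - (C.mean e + s * u)) / s := by
          field_simp; ring
        rw [mem_ofPred_eq, mem_ofPred_eq, this, abs_div, abs_of_pos hs, div_le_one hs]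

theorem invCdfE_mem (hE : emin ≤ emax) (hμ : ∀ᵐ e ∂μ, e ∈ Icc emin emax) {t : ℝ} (ht : t ≤ 1) :
    C.invCdfE μ t ∈ Icc emin emax ∧ emax ∈ {e | e ∈ Icc emin emax ∧ t ≤ C.cdfE μ e} := by
  have h1 : C.cdfE μ emax = 1 := by
    have h : μ (Iic emax) = 1 :=
      (mem_ae_iff_prob_eq_one measurableSet_Iic).1 (hμ.mono fun e he => he.2)
    simp [cdfE, measureReal_def, h]
  have hmem : emax ∈ {e | e ∈ Icc emin emax ∧ t ≤ C.cdfE μ e} :=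
    ⟨right_mem_Icc.2 hE, by rwa [h1]⟩
  exact ⟨⟨le_csInf ⟨_, hmem⟩ fun e he => he.1.1, csInf_le ⟨emin, fun e he => he.1.1⟩ hmem⟩, hmem⟩

/-- At the generalised inverse, the distribution function overshoots at most by the mass of a
window. -/
theorem abs_cdfE_invCdfE_sub_le {s D : ℝ} (hE : emin ≤ emax) (hs : 0 < s)
    (hc : ContinuousOn C.mean (Icc emin emax)) (hμ : ∀ᵐ e ∂μ, e ∈ Icc emin emax)
    (hD : ∀ c, μ.real {e | |C.mean e - c| ≤ s} ≤ D) {t : ℝ} (ht : t ∈ Ioo (0 : ℝ) 1) :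
    |C.cdfE μ (C.invCdfE μ t) - t| ≤ D := by
  obtain ⟨h0, hne⟩ := C.invCdfE_mem hE hμ ht.2.le
  set e₀ := C.invCdfE μ t with he₀
  have hmono : Monotone (C.cdfE μ) := fun x y hxy => measureReal_mono (Iic_subset_Iic.2 hxy)
  -- The infimum is attained, by right continuity of the distribution function.
  have hge : t ≤ C.cdfE μ e₀ := by
    have hr : Filter.Tendsto (C.cdfE μ) (nhdsWithin e₀ (Ioi e₀)) (nhds (C.cdfE μ e₀)) := by
      have h := ((ProbabilityTheory.cdf μ).right_continuous e₀).mono Ioi_subset_Ici_self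
      have h2 : C.cdfE μ = ProbabilityTheory.cdf μ := by
        ext x; rw [ProbabilityTheory.cdf_eq_real]; rfl
      rw [h2]; exact h
    refine ge_of_tendsto hr (eventually_nhdsWithin_of_forall fun e he => ?_)
    obtain ⟨x, hx, hxe⟩ := exists_lt_of_csInf_lt ⟨_, hne⟩ (show e₀ < e from he)
    exact hx.2.trans (hmono hxe.le)
  obtain ⟨δ, hδ, hδs⟩ := Metric.continuousOn_iff.1 hc e₀ h0 s hs
  -- Just left of the infimum the level `t` is not reached; below `emin` the distribution function
  -- vanishes.
  have hlt : C.cdfE μ (e₀ - δ / 2) ≤ t := by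
    by_contra! hcon
    by_cases hm : emin ≤ e₀ - δ / 2
    · have : e₀ ≤ e₀ - δ / 2 := csInf_le ⟨emin, fun e he => he.1.1⟩
        ⟨⟨hm, by linarith [h0.2]⟩, hcon.le⟩
      linarith
    · have hz : C.cdfE μ (e₀ - δ / 2) = 0 := by
        rw [cdfE, measureReal_eq_zero_iff]
        refine measure_mono_null (fun x hx => ?_) hμ
        intro hx2
        exact hm (hx2.1.trans hx)
      linarith [ht.1]
  have hsub : C.cdfE μ e₀ ≤ C.cdfE μ (e₀ - δ / 2) + D := by
    have h1 : C.cdfE μ e₀ ≤ C.cdfE μ (e₀ - δ / 2) + μ.real (Ioc (e₀ - δ / 2) e₀) := by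
      unfold cdfE
      rw [← Iic_union_Ioc_eq_Iic (show e₀ - δ / 2 ≤ e₀ by linarith)]
      exact measureReal_union_le _ _
    have h2 : μ.real (Ioc (e₀ - δ / 2) e₀) ≤ μ.real {e | |C.mean e - C.mean e₀| ≤ s} := by
      refine ENNReal.toReal_mono (measure_ne_top _ _) (measure_mono_ae ?_)
      filter_upwards [hμ] with e he hmem
      have h3 : dist e e₀ < δ := by
        rw [Real.dist_eq, abs_lt]
        constructor <;> linarith [hmem.1, hmem.2]
      exact (hδs e he h3).le
    linarith [hD (C.mean e₀)]
  rw [abs_le]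
  constructor <;> linarith [(measureReal_nonneg (μ := μ)).trans (hD 0)]

end Law

end Channel

end

/-- The constant `K` depends only on the range of `E`, on a lower bound `ρ` for the total increase
of the conditional mean, on the rate `L` of relative change of `σ(e)`, and on the lower bound `-κ`
for the entropies of the standardised conditional densities `φ(x|e) = σ(e) f(m(e) + σ(e) x | e)`
(these entropies are `h(Q|e) - log₂ σ(e)`). -/
theorem corollary3 (emin emax ρ L κ : ℝ) (hE : emin < emax) (hρ : 0 < ρ) :
    ∃ K : ℝ, ∀ C : Channel emin emax,
      -- positive correlation: `m` is differentiable with `m' > 0`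
      ContinuousOn C.mean (Set.Icc emin emax) →
      DifferentiableOn ℝ C.mean (Set.Ioo emin emax) →
      (∀ e ∈ Set.Ioo emin emax, 0 < deriv C.mean e) →
      ρ ≤ C.mean emax - C.mean emin →
      -- slow change of `σ`: `|d ln σ(e) / de| ≤ L`
      ContinuousOn C.sd (Set.Icc emin emax) →
      DifferentiableOn ℝ C.sd (Set.Ioo emin emax) →
      (∀ e ∈ Set.Ioo emin emax, |deriv C.sd e| ≤ L * C.sd e) →
      -- the standardised conditional densities do not degenerate
      (∀ e ∈ Set.Icc emin emax, -κ ≤ C.condEntropy e - Real.logb 2 (C.sd e)) →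
      -- an information-maximising law of `E`, among the laws with a density or among all laws
      ∀ μ : MeasureTheory.Measure ℝ,
        (C.IsInfoMaximising C.densityLaws μ ∨ C.IsInfoMaximising C.allLaws μ) →
        (∀ eStar ∈ Set.Ioo (0 : ℝ) 1, |C.mStar μ eStar - eStar| ≤ K * C.sdMax) ∧
        (∀ e ∈ Set.Icc emin emax, |C.meanQStar μ e - C.cdfE μ e| ≤ K * C.sdMax) := by
  set D : ℝ := Real.pi ^ 2 / ρ * Real.exp (L * (emax - emin) + κ * Real.log 2 + 4) with hDdef
  have hD0 : 0 ≤ D := by positivity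
  -- The first summand bounds the ordering error, the second the overshoot at the quantile.
  refine ⟨5 * (3 / 2 * (Real.pi * D)) + D, ?_⟩
  intro C hmc hmd hmpos hmρ hsc hsd hsL hκ μ hopt
  have hlaw : μ ∈ C.allLaws := by
    rcases hopt with h | h
    exacts [h.1.1, h.1]
  have hprob : IsProbabilityMeasure μ := hlaw.1
  have hμ : ∀ᵐ e ∂μ, e ∈ Icc emin emax := hlaw.2
  have hsmax : ∀ e ∈ Icc emin emax, C.sd e ≤ C.sdMax := fun e he => C.sd_le_sdMax hsc he
  have hs : 0 < C.sdMax :=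
    (C.sd_pos (left_mem_Icc.2 hE.le)).trans_le (hsmax _ (left_mem_Icc.2 hE.le))
  have hm : StrictMonoOn C.mean (Icc emin emax) :=
    strictMonoOn_of_deriv_pos (convex_Icc _ _) hmc (by rwa [interior_Icc])
  -- `log σ(e)` is within `L (emax - emin)` of its maximum, and `κ` bits are `κ log 2` nats.
  have hl : ∀ e ∈ Icc emin emax,
      Real.log C.sdMax - (L * (emax - emin) + κ * Real.log 2) ≤ C.condEntropyNat e := by
    intro e he
    have h1 := C.log_sdMax_le hE hsc hsd hsL he
    have h2 := hκ e he
    have hlog := Real.log_pos one_lt_two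
    rw [C.condEntropy_eq, Real.logb, ← sub_div, le_div_iff₀ hlog] at h2
    linarith
  have hwin := C.window_le hE.le hρ hmρ hmc hmd hmpos hs hsmax hl hμ hopt
  have hB : ∀ e ∈ Icc emin emax,
      |C.meanQStar μ e - C.cdfE μ e| ≤ 5 * (3 / 2 * (Real.pi * D)) * C.sdMax := by
    intro e he
    refine (C.abs_meanQStar_sub_cdfE_le hs hsmax hm hμ hwin he).trans_eq ?_
    ring
  have hDs : 0 ≤ D * C.sdMax := mul_nonneg hD0 hs.le
  constructor
  · intro t ht
    have h1 := hB _ (C.invCdfE_mem hE.le hμ ht.2.le).1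
    have h2 := C.abs_cdfE_invCdfE_sub_le hE.le hs hmc hμ hwin ht
    have h3 := abs_sub_le (C.mStar μ t) (C.cdfE μ (C.invCdfE μ t)) t
    change |C.mStar μ t - _| ≤ _ at h1
    rw [add_mul]
    linarith
  · intro e he
    rw [add_mul]
    linarith [hB e he]
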